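/- Let $(M^2,g)$ be a smooth connected two-dimensional Riemannian manifold, $(N^n,h)$ a smooth Riemannian manifold, and $\varphi:M\to N$ a smooth Riemannian (isometric) immersion. Let $B$ be its second fundamental form, $H=\frac12\operatorname{trace}B$ its mean curvature vector field, and $A_H$ the shape operator in the direction of $H$, i.e. the tensor field of type $(1,1)$ on $M$ with $\langle A_H X,Y\rangle=\langle B(X,Y),H\rangle$. Suppose that $A_H$ is parallel, $\nabla A_H=0$, where $\nabla$ is the Levi-Civita connection of $M$. Then either $M$ is pseudoumbilical, i.e. $A_H=|H|^2 I$ at every point of $M$, where $I$ is the identity tensor field, or $M$ is flat, i.e. its curvature tensor (equivalently, its Gaussian curvature) vanishes identically; the two alternatives are not exclusive. -/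

import Mathlib

open Bundle Manifold VectorField FiberBundle
open scoped ContDiff

noncomputable section

namespace Riem

section LeviCivita

variable {E : Type*} [NormedAddCommGroup E] [NormedSpace ℝ E]
  {H : Type*} [TopologicalSpace H] {I : ModelWithCorners ℝ E H}
  {M : Type*} [TopologicalSpace M] [ChartedSpace H M]
  [RiemannianBundle (fun x : M => TangentSpace I x)]

/-- The right-hand side of the Koszul formula at the point `x`. -/
def koszul (X Y Z : Π x : M, TangentSpace I x) (x : M) : ℝ :=
  d% (fun q => inner ℝ (Y q) (Z q)) x (X x)
    + d% (fun q => inner ℝ (X q) (Z q)) x (Y x)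
    - d% (fun q => inner ℝ (X q) (Y q)) x (Z x)
    + inner ℝ (mlieBracket I X Y x) (Z x)
    - inner ℝ (mlieBracket I X Z x) (Y x)
    - inner ℝ (mlieBracket I Y Z x) (X x)

variable [IsManifold I ∞ M]
  [IsContMDiffRiemannianBundle I ∞ E (fun x : M => TangentSpace I x)]

variable {X X' Y Y' Z : Π x : M, TangentSpace I x} {f : M → ℝ} {x : M}

theorem mdifferentiableAt_inner (hX : MDiffAt (T% X) x) (hY : MDiffAt (T% Y) x) :
    MDiffAt (fun q => inner ℝ (X q) (Y q)) x :=
  MDifferentiableAt.inner_bundle (IB := I) (IM := I) (b := id) (B := M) (F := E)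
    (E := fun x : M => TangentSpace I x) (v := X) (w := Y) hX hY

variable [FiniteDimensional ℝ E]

theorem tensorial_koszul_left (hY : MDiffAt (T% Y) x) (hZ : MDiffAt (T% Z) x) :
    TensorialAt I E (koszul · Y Z x) x where
  smul {f X} hf hX := by
    have := FiniteDimensional.complete ℝ E
    have h1 := mvfderiv_fun_mul hf (mdifferentiableAt_inner hX hZ)
    have h2 := mvfderiv_fun_mul hf (mdifferentiableAt_inner hX hY)
    simp [koszul, inner_smul_left, h1, h2, mlieBracket_smul_left hf hX, inner_add_left,
      inner_smul_right]
    ring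
  add {X X'} hX hX' := by
    have := FiniteDimensional.complete ℝ E
    have h1 := mvfderiv_fun_add (mdifferentiableAt_inner hX hZ) (mdifferentiableAt_inner hX' hZ)
    have h2 := mvfderiv_fun_add (mdifferentiableAt_inner hX hY) (mdifferentiableAt_inner hX' hY)
    simp [koszul, h1, h2, mlieBracket_add_left hX hX', inner_add_left, inner_add_right]
    ring

theorem tensorial_koszul_right (hX : MDiffAt (T% X) x) (hY : MDiffAt (T% Y) x) :
    TensorialAt I E (koszul X Y · x) x where
  smul {f Z} hf hZ := by
    have := FiniteDimensional.complete ℝ E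
    have h1 := mvfderiv_fun_mul hf (mdifferentiableAt_inner hX hZ)
    have h2 := mvfderiv_fun_mul hf (mdifferentiableAt_inner hY hZ)
    simp [koszul, inner_smul_left, h1, h2, mlieBracket_smul_right hf hZ, inner_add_left,
      inner_smul_right]
    rw [real_inner_comm (Z x) (Y x), real_inner_comm (Z x) (X x)]
    ring
  add {Z Z'} hZ hZ' := by
    have := FiniteDimensional.complete ℝ E
    have h1 := mvfderiv_fun_add (mdifferentiableAt_inner hX hZ) (mdifferentiableAt_inner hX hZ')
    have h2 := mvfderiv_fun_add (mdifferentiableAt_inner hY hZ) (mdifferentiableAt_inner hY hZ')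
    simp [koszul, h1, h2, mlieBracket_add_right hZ hZ', inner_add_left, inner_add_right]
    ring

open Classical in
/-- The Levi-Civita derivative `v ↦ ∇_v Y` at `x` of a vector field `Y` differentiable at `x`:
the solution of the Koszul formula `2⟨∇_X Y, Z⟩ = koszul X Y Z` (it is `0` by convention if `Y` is
not differentiable at `x`). -/
def nabla (Y : Π x : M, TangentSpace I x) (x : M) : TangentSpace I x →L[ℝ] TangentSpace I x :=
  haveI : FiniteDimensional ℝ (TangentSpace I x) := inferInstanceAs (FiniteDimensional ℝ E)
  haveI : CompleteSpace (TangentSpace I x) := FiniteDimensional.complete ℝ _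
  if hY : MDiffAt (T% Y) x then
    letI K : TangentSpace I x →L[ℝ] TangentSpace I x →L[ℝ] ℝ :=
      TensorialAt.mkHom₂ (I := I) (F := E) (F' := E)
        (fun X Z : Π x : M, TangentSpace I x => koszul X Y Z x) x
        (fun _ hZ => tensorial_koszul_left hY hZ)
        (fun _ hX => tensorial_koszul_right hX hY)
    LinearMap.toContinuousLinearMap
      { toFun v := (InnerProductSpace.toDual ℝ (TangentSpace I x)).symm ((2 : ℝ)⁻¹ • K v)
        map_add' v w := by simp
        map_smul' c v := by rw [K.map_smul, smul_comm]; simp only [map_smulₛₗ]; rfl }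
  else 0

theorem inner_nabla (hX : MDiffAt (T% X) x) (hY : MDiffAt (T% Y) x) (hZ : MDiffAt (T% Z) x) :
    inner ℝ (nabla Y x (X x)) (Z x) = 2⁻¹ * koszul X Y Z x := by
  have h := TensorialAt.mkHom₂_apply (I := I) (F := E) (F' := E)
        (Φ := fun X Z : Π x : M, TangentSpace I x => koszul X Y Z x)
        (fun _ hZ => tensorial_koszul_left hY hZ)
        (fun _ hX => tensorial_koszul_right hX hY) hX hZ
  have : FiniteDimensional ℝ (TangentSpace I x) := inferInstanceAs (FiniteDimensional ℝ E)
  have : CompleteSpace (TangentSpace I x) := FiniteDimensional.complete ℝ _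
  rw [nabla, dif_pos hY, ← h]
  exact InnerProductSpace.toDual_symm_apply (𝕜 := ℝ)

theorem koszul_add (hX : MDiffAt (T% X) x) (hY : MDiffAt (T% Y) x) (hY' : MDiffAt (T% Y') x)
    (hZ : MDiffAt (T% Z) x) :
    koszul X (Y + Y') Z x = koszul X Y Z x + koszul X Y' Z x := by
  have := FiniteDimensional.complete ℝ E
  have h1 := mvfderiv_fun_add (mdifferentiableAt_inner hY hZ) (mdifferentiableAt_inner hY' hZ)
  have h2 := mvfderiv_fun_add (mdifferentiableAt_inner hX hY) (mdifferentiableAt_inner hX hY')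
  simp [koszul, h1, h2, mlieBracket_add_left hY hY', mlieBracket_add_right hY hY',
    inner_add_left, inner_add_right]
  ring

theorem koszul_smul (hX : MDiffAt (T% X) x) (hf : MDiffAt f x) (hY : MDiffAt (T% Y) x)
    (hZ : MDiffAt (T% Z) x) :
    koszul X (f • Y) Z x = f x * koszul X Y Z x + 2 * (d% f x (X x) * inner ℝ (Y x) (Z x)) := by
  have := FiniteDimensional.complete ℝ E
  have h1 := mvfderiv_fun_mul hf (mdifferentiableAt_inner hY hZ)
  have h2 := mvfderiv_fun_mul hf (mdifferentiableAt_inner hX hY)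
  simp [koszul, h1, h2, mlieBracket_smul_left hf hY, mlieBracket_smul_right hf hY,
    inner_add_left, inner_smul_left, inner_smul_right]
  rw [real_inner_comm (X x) (Y x)]
  ring

variable (I M) in
/-- The Levi-Civita connection of a Riemannian manifold, as a covariant derivative on the tangent
bundle: `leviCivita I M Y x v` is `∇_v Y` at `x`. -/
def leviCivita : CovariantDerivative I E (fun x : M => TangentSpace I x) where
  toFun := nabla
  isCovariantDerivativeOnUniv :=
    { add := by
        intro Y Y' x hY hY' _
        ext1 v
        refine ext_inner_right ℝ fun w => ?_
        have hX := mdifferentiableAt_extend I E v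
        have hZ := mdifferentiableAt_extend I E w
        have h1 := inner_nabla hX (mdifferentiableAt_add_section hY hY') hZ
        have h2 := inner_nabla hX hY hZ
        have h3 := inner_nabla hX hY' hZ
        have h4 := koszul_add hX hY hY' hZ
        simp only [extend_apply_self] at h1 h2 h3
        simp only [add_apply, inner_add_left]
        rw [h2, h3, ← mul_add, ← h4]
        exact h1
      leibniz := by
        intro Y f x hY hf _
        ext1 v
        refine ext_inner_right ℝ fun w => ?_
        have hX := mdifferentiableAt_extend I E v
        have hZ := mdifferentiableAt_extend I E w
        have h1 := inner_nabla hX (hf.smul_section hY) hZ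
        have h2 := inner_nabla hX hY hZ
        have h4 := koszul_smul hX hf hY hZ
        simp only [extend_apply_self] at h1 h2 h4
        simp only [add_apply, smul_apply,
          ContinuousLinearMap.smulRight_apply, inner_add_left, real_inner_smul_left]
        rw [h2]
        refine h1.trans ?_
        rw [h4]
        ring }

/-- The Levi-Civita connection is torsion-free. -/
theorem torsion_leviCivita : (leviCivita I M).torsion = 0 := by
  have := FiniteDimensional.complete ℝ E
  rw [CovariantDerivative.torsion_eq_zero_iff]
  intro X Y x hX hY
  refine ext_inner_right ℝ fun w => ?_
  have hZ := mdifferentiableAt_extend I E w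
  have h1 := inner_nabla hX hY hZ
  have h2 := inner_nabla hY hX hZ
  simp only [extend_apply_self] at h1 h2
  rw [inner_sub_left]
  refine (congrArg₂ (· - ·) h1 h2).trans ?_
  have e : (fun q => inner ℝ (X q) (Y q)) = fun q => inner ℝ (Y q) (X q) :=
    funext fun q => real_inner_comm _ _
  simp only [koszul, e, extend_apply_self, mlieBracket_swap_apply (V := Y) (W := X),
    inner_neg_left]
  ring

/-- The Levi-Civita connection is compatible with the metric. -/
theorem mvfderiv_inner_leviCivita (hX : MDiffAt (T% X) x) (hY : MDiffAt (T% Y) x)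
    (hZ : MDiffAt (T% Z) x) :
    d% (fun q => inner ℝ (Y q) (Z q)) x (X x) =
      inner ℝ (leviCivita I M Y x (X x)) (Z x) + inner ℝ (Y x) (leviCivita I M Z x (X x)) := by
  have h1 := inner_nabla hX hY hZ
  have h2 := inner_nabla hX hZ hY
  rw [real_inner_comm] at h2
  refine Eq.trans ?_ (congrArg₂ (· + ·) h1 h2).symm
  have e : (fun q => inner ℝ (Z q) (Y q)) = fun q => inner ℝ (Y q) (Z q) :=
    funext fun q => real_inner_comm _ _
  simp only [koszul, e, mlieBracket_swap_apply (V := Z) (W := Y), inner_neg_left]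
  ring

variable (I) in
/-- The curvature tensor `R(u, v)w = ∇_U ∇_V W - ∇_V ∇_U W - ∇_{[U, V]} W` at `x`, where `U, V, W`
are smooth local extensions of the tangent vectors `u, v, w` at `x`. -/
def curvature (x : M) (u v w : TangentSpace I x) : TangentSpace I x :=
  letI U : Π q : M, TangentSpace I q := extend E u
  letI V : Π q : M, TangentSpace I q := extend E v
  letI W : Π q : M, TangentSpace I q := extend E w
  leviCivita I M (fun q => leviCivita I M W q (V q)) x u
    - leviCivita I M (fun q => leviCivita I M W q (U q)) x v
    - leviCivita I M W x (mlieBracket I U V x)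

variable (I M) in
/-- The Riemannian manifold `M` is flat: its curvature tensor vanishes identically. For a surface
this says that the Gaussian curvature vanishes identically. -/
def IsFlat : Prop :=
  ∀ (x : M) (u v w : TangentSpace I x), curvature I x u v w = 0

/-- A smooth tensor field `A` of type `(1,1)` is parallel, `∇A = 0`:
`(∇_v A)(Y) = ∇_v (A Y) - A (∇_v Y)` is zero for every tangent vector `v` and every vector
field `Y`. -/
def IsParallel (A : Π x : M, TangentSpace I x →L[ℝ] TangentSpace I x) : Prop :=
  ∀ (x : M) (v : TangentSpace I x) (Y : Π q : M, TangentSpace I q), MDiffAt (T% Y) x →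
    leviCivita I M (fun q => A q (Y q)) x v - A x (leviCivita I M Y x v) = 0

end LeviCivita

section Submanifold

variable {E : Type*} [NormedAddCommGroup E] [NormedSpace ℝ E] [FiniteDimensional ℝ E]
  {H : Type*} [TopologicalSpace H] (I : ModelWithCorners ℝ E H)
  {M : Type*} [TopologicalSpace M] [ChartedSpace H M] [IsManifold I ∞ M]
  [RiemannianBundle (fun x : M => TangentSpace I x)]
  [IsContMDiffRiemannianBundle I ∞ E (fun x : M => TangentSpace I x)]
  {E' : Type*} [NormedAddCommGroup E'] [NormedSpace ℝ E'] [FiniteDimensional ℝ E']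
  {H' : Type*} [TopologicalSpace H'] (J : ModelWithCorners ℝ E' H')
  {N : Type*} [TopologicalSpace N] [ChartedSpace H' N] [IsManifold J ∞ N]
  [RiemannianBundle (fun y : N => TangentSpace J y)]
  [IsContMDiffRiemannianBundle J ∞ E' (fun y : N => TangentSpace J y)]

/-- `φ : M → N` is a smooth Riemannian (i.e. isometric) immersion. -/
structure IsRiemannianImmersion (φ : M → N) : Prop where
  contMDiff : ContMDiff I J ∞ φ
  inner_mfderiv : ∀ (p : M) (u v : TangentSpace I p),
    (inner ℝ (mfderiv I J φ p u) (mfderiv I J φ p v) : ℝ) = inner ℝ u v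

/-- The pull-back to `φ⁻¹(TN)` of the Levi-Civita connection of `N`: the derivative `u ↦ ∇^φ_u V`
at `p` of a vector field `V` along `φ`. In a local frame `(W_a)` of `TN` around `φ p`, with
`V = ∑ V^a (W_a ∘ φ)`, it is `∑ (u V^a) W_a + V^a(p) ∇^N_{dφ u} W_a`; here the frame is that of the
preferred local trivialization of `TN` at `φ p`, so that `extend E' (V p)` is the vector field
`∑ V^a(p) W_a`. -/
def pullbackNabla (φ : M → N) (V : Π q : M, TangentSpace J (φ q)) (p : M) :
    TangentSpace I p →L[ℝ] TangentSpace J (φ p) :=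
  letI t := trivializationAt E' (TangentSpace J : N → Type _) (φ p)
  (t.symmL ℝ (φ p)) ∘L (d% (fun q : M => (t ⟨φ q, V q⟩).2) p)
    + (leviCivita J N (extend E' (V p)) (φ p)) ∘L (mfderiv I J φ p)

/-- The second fundamental form `B(u, v)` of `φ` at `p`, as a linear map in `u`, given by the Gauss
formula `∇^φ_u (dφ V) = dφ (∇_u V) + B(u, v)`, where `V` is a smooth local extension of `v`. -/
def secondFundamentalForm (φ : M → N) (p : M) (v : TangentSpace I p) :
    TangentSpace I p →L[ℝ] TangentSpace J (φ p) :=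
  letI V : Π q : M, TangentSpace I q := extend E v
  pullbackNabla I J φ (fun q => mfderiv I J φ q (V q)) p
    - (mfderiv I J φ p) ∘L (leviCivita I M V p)

/-- The orthonormal basis of `T_pM` used to compute traces; traces do not depend on it. -/
def tangentBasis (p : M) :
    OrthonormalBasis (Fin (Module.finrank ℝ E)) ℝ (TangentSpace I p) :=
  haveI : FiniteDimensional ℝ (TangentSpace I p) := inferInstanceAs (FiniteDimensional ℝ E)
  stdOrthonormalBasis ℝ (TangentSpace I p)

/-- The mean curvature vector field `H = (1/m) trace B`, where `m` is the dimension of `M`. -/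
def meanCurvature (φ : M → N) (p : M) : TangentSpace J (φ p) :=
  (Module.finrank ℝ E : ℝ)⁻¹ •
    ∑ i, secondFundamentalForm I J φ p (tangentBasis I p i) (tangentBasis I p i)

/-- The shape operator `A_ξ` at `p` in the direction `ξ`, characterized by
`⟨A_ξ u, v⟩ = ⟨B(u, v), ξ⟩`; that is, `A_ξ u = ∑ i, ⟨ξ, B(u, e_i)⟩ e_i` for an orthonormal
basis `(e_i)` of `T_pM`. -/
def shapeOperator (φ : M → N) (p : M) (ξ : TangentSpace J (φ p)) :
    TangentSpace I p →L[ℝ] TangentSpace I p :=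
  ∑ i, ((innerSL ℝ ξ) ∘L secondFundamentalForm I J φ p (tangentBasis I p i)).smulRight
    (tangentBasis I p i)

/-- The tensor field `A_H`, the shape operator in the direction of the mean curvature vector. -/
def shapeOperatorH (φ : M → N) (p : M) : TangentSpace I p →L[ℝ] TangentSpace I p :=
  shapeOperator I J φ p (meanCurvature I J φ p)

/-- `M` is pseudoumbilical in `N`: `A_H = |H|² I`. -/
def IsPseudoumbilical (φ : M → N) : Prop :=
  ∀ p : M, shapeOperatorH I J φ p =
    ‖meanCurvature I J φ p‖ ^ 2 • ContinuousLinearMap.id ℝ (TangentSpace I p)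

end Submanifold

end Riem

end

noncomputable section

namespace Riem

section Smoothness

variable {E : Type*} [NormedAddCommGroup E] [NormedSpace ℝ E]
  {H : Type*} [TopologicalSpace H] {I : ModelWithCorners ℝ E H}
  {M : Type*} [TopologicalSpace M] [ChartedSpace H M] [IsManifold I ∞ M]
  {E' : Type*} [NormedAddCommGroup E'] [NormedSpace ℝ E']
  {H' : Type*} [TopologicalSpace H'] {J : ModelWithCorners ℝ E' H'}
  {N : Type*} [TopologicalSpace N] [ChartedSpace H' N] [IsManifold J ∞ N]
  {X Y : Π x : M, TangentSpace I x} {x : M}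

theorem eventually_mdifferentiableAt {f : M → N} (hf : CMDiffAt ∞ f x) :
    ∀ᶠ q in nhds x, MDiffAt f q := by
  filter_upwards [contMDiffAt_iff_contMDiffAt_nhds (by simp) |>.1
    (hf.of_le (m := 1) (by norm_cast))] with q h
  exact h.mdifferentiableAt one_ne_zero

/-- The push-forward of a smooth vector field is a smooth vector field along the map. -/
theorem contMDiffAt_mfderiv_apply {φ : M → N} (hφ : CMDiffAt ∞ φ x) (hX : CMDiffAt ∞ (T% X) x) :
    ContMDiffAt I J.tangent ∞
      (fun q => (⟨φ q, mfderiv I J φ q (X q)⟩ : TangentBundle J N)) x :=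
  ContMDiffAt.clm_apply_of_inCoordinates (b₁ := id) (b₂ := φ)
    (hφ.mfderiv_const (by simp)) hX hφ

theorem mdifferentiableAt_mfderiv_apply {φ : M → N} (hφ : CMDiffAt ∞ φ x)
    (hX : MDiffAt (T% X) x) :
    MDifferentiableAt I J.tangent
      (fun q => (⟨φ q, mfderiv I J φ q (X q)⟩ : TangentBundle J N)) x :=
  MDifferentiableAt.clm_apply_of_inCoordinates (b₁ := id) (b₂ := φ)
    ((hφ.mfderiv_const (m := 1) (by norm_cast)).mdifferentiableAt one_ne_zero) hX
    (hφ.mdifferentiableAt (by simp))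

theorem contMDiffAt_mvfderiv_apply {F : Type*} [NormedAddCommGroup F] [NormedSpace ℝ F]
    {f : M → F} (hf : CMDiffAt ∞ f x) (hX : CMDiffAt ∞ (T% X) x) :
    CMDiffAt ∞ (fun q => d% f q (X q)) x := by
  have h := (Bundle.contMDiffAt_totalSpace).1 (contMDiffAt_mfderiv_apply hf hX)
  refine h.2.congr_of_eventuallyEq (Filter.Eventually.of_forall fun q => ?_)
  exact congrArg Prod.snd
    (trivializationAt_model_space_apply (I := 𝓘(ℝ, F))
      (⟨f q, mfderiv I 𝓘(ℝ, F) f q (X q)⟩) (f x)).symm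

theorem mdifferentiableAt_mvfderiv_apply {F : Type*} [NormedAddCommGroup F] [NormedSpace ℝ F]
    {f : M → F} (hf : CMDiffAt ∞ f x) (hX : MDiffAt (T% X) x) :
    MDiffAt (fun q => d% f q (X q)) x := by
  have h := (mdifferentiableAt_totalSpace _ _).1 (mdifferentiableAt_mfderiv_apply hf hX)
  refine h.2.congr_of_eventuallyEq (Filter.Eventually.of_forall fun q => ?_)
  exact congrArg Prod.snd
    (trivializationAt_model_space_apply (I := 𝓘(ℝ, F))
      (⟨f q, mfderiv I 𝓘(ℝ, F) f q (X q)⟩) (f x)).symm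

theorem contMDiffAt_mlieBracket [CompleteSpace E] (hX : CMDiffAt ∞ (T% X) x)
    (hY : CMDiffAt ∞ (T% Y) x) : CMDiffAt ∞ (T% (mlieBracket I X Y)) x :=
  have : IsManifold I (minSmoothness ℝ 2) M := by
    rw [minSmoothness_of_isRCLikeNormedField]; infer_instance
  have : IsManifold I (((⊤ : ℕ∞) : WithTop ℕ∞) + 1) M := ‹IsManifold I ∞ M›
  ContMDiffAt.mlieBracket_vectorField (m := ⊤) (n := ⊤) hX hY (by simp)

omit [IsManifold I ∞ M] in
theorem mvfderiv_congr {F : Type*} [NormedAddCommGroup F] [NormedSpace ℝ F]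
    {f g : M → F} (h : f =ᶠ[nhds x] g) : d% f x = d% g x := by
  ext v
  simp only [mvfderiv, h.mfderiv_eq]
  rfl

/-- The Lie bracket is the commutator of derivations. -/
theorem mvfderiv_mlieBracket [CompleteSpace E] {f : M → ℝ} (hf : CMDiffAt ∞ f x)
    (hX : CMDiffAt ∞ (T% X) x) (hY : CMDiffAt ∞ (T% Y) x) :
    d% f x (mlieBracket I X Y x) =
      d% (fun q => d% f q (Y q)) x (X x) - d% (fun q => d% f q (X q)) x (Y x) := by
  have : IsManifold I (minSmoothness ℝ 3) M := by
    rw [minSmoothness_of_isRCLikeNormedField]; infer_instance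
  by_cases hE : ∀ v : TangentSpace I x, v = 0
  · simp [hE]
  push Not at hE
  obtain ⟨v, hv⟩ := hE
  have aux {V Z : Π x : M, TangentSpace I x} {g : M → ℝ} (hg : CMDiffAt ∞ g x)
      (hZ : CMDiffAt ∞ (T% Z) x) :
      mlieBracket I V (g • Z) =ᶠ[nhds x]
        (fun q => d% g q (V q)) • Z + g • mlieBracket I V Z := by
    filter_upwards [eventually_mdifferentiableAt hg, eventually_mdifferentiableAt hZ] with q h1 h2
    exact mlieBracket_smul_right h1 h2
  have key {V V' Z : Π x : M, TangentSpace I x} (hV : CMDiffAt ∞ (T% V) x)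
      (hV' : CMDiffAt ∞ (T% V') x) (hZ : CMDiffAt ∞ (T% Z) x) :
      mlieBracket I V (mlieBracket I V' (f • Z)) x =
        d% (fun q => d% f q (V' q)) x (V x) • Z x + d% f x (V' x) • mlieBracket I V Z x +
        (d% f x (V x) • mlieBracket I V' Z x + f x • mlieBracket I V (mlieBracket I V' Z) x) := by
    have h1 := contMDiffAt_mvfderiv_apply hf hV'
    have h2 := contMDiffAt_mlieBracket hV' hZ
    rw [Filter.EventuallyEq.mlieBracket_vectorField_eq (Filter.EventuallyEq.refl _ V)
        (aux (V := V') hf hZ),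
      mlieBracket_add_right ((h1.smul_section hZ).mdifferentiableAt (by simp))
        ((hf.smul_section h2).mdifferentiableAt (by simp)),
      mlieBracket_smul_right (h1.mdifferentiableAt (by simp)) (hZ.mdifferentiableAt (by simp)),
      mlieBracket_smul_right (hf.mdifferentiableAt (by simp)) (h2.mdifferentiableAt (by simp))]
  have hZ : CMDiffAt ∞ (T% (extend E v : Π q : M, TangentSpace I q)) x :=
    contMDiffAt_extend (k := ∞) I E v
  have h2 : minSmoothness ℝ 2 ≤ ∞ := by
    rw [minSmoothness_of_isRCLikeNormedField]; norm_cast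
  have J1 := leibniz_identity_mlieBracket_apply (hX.of_le h2) (hY.of_le h2)
    ((hf.smul_section hZ).of_le h2)
  have J2 := leibniz_identity_mlieBracket_apply (hX.of_le h2) (hY.of_le h2) (hZ.of_le h2)
  rw [key hX hY hZ, key hY hX hZ, (aux hf hZ).eq_of_nhds, J2] at J1
  simp only [Pi.add_apply, Pi.smul_apply', extend_apply_self] at J1
  rw [← sub_eq_zero]
  refine (smul_eq_zero.1 ?_).resolve_right hv
  rw [← sub_eq_zero] at J1
  rw [← neg_eq_zero, ← J1]
  module

end Smoothness

section LeviCivitaSmooth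

variable {E : Type*} [NormedAddCommGroup E] [NormedSpace ℝ E] [FiniteDimensional ℝ E]
  {H : Type*} [TopologicalSpace H] {I : ModelWithCorners ℝ E H}
  {M : Type*} [TopologicalSpace M] [ChartedSpace H M] [IsManifold I ∞ M]
  [RiemannianBundle (fun x : M => TangentSpace I x)]
  [IsContMDiffRiemannianBundle I ∞ E (fun x : M => TangentSpace I x)]
  {X Y Z W : Π x : M, TangentSpace I x} {x : M}

omit [FiniteDimensional ℝ E] in
theorem contMDiffAt_inner (hX : CMDiffAt ∞ (T% X) x) (hY : CMDiffAt ∞ (T% Y) x) :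
    CMDiffAt ∞ (fun q => (inner ℝ (X q) (Y q) : ℝ)) x :=
  ContMDiffAt.inner_bundle (IB := I) (IM := I) (b := id) (B := M) (F := E)
    (E := fun x : M => TangentSpace I x) (v := X) (w := Y) hX hY

variable (I) in
/-- Every point has a neighbourhood with a smooth orthonormal frame. -/
theorem exists_orthonormal_frame (x : M) :
    ∃ e : Fin (Module.finrank ℝ E) → Π q : M, TangentSpace I q,
      (∀ i, CMDiffAt ∞ (T% (e i)) x) ∧ ∀ᶠ q in nhds x, Orthonormal ℝ (fun i => e i q) := by
  set t := trivializationAt E (TangentSpace I : M → Type _) x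
  set s := t.localFrame (Module.finBasis ℝ E)
  have hx : x ∈ t.baseSet := FiberBundle.mem_baseSet_trivializationAt' x
  have hs := t.isLocalFrameOn_localFrame_baseSet I ∞ (Module.finBasis ℝ E)
  have hs1 i : CMDiffAt ∞ (T% (s i)) x := hs.contMDiffAt t.open_baseSet hx i
  let g : Fin (Module.finrank ℝ E) → Π q : M, TangentSpace I q :=
    fun i q => InnerProductSpace.gramSchmidt ℝ (fun j => s j q) i
  have hli : LinearIndependent ℝ (fun j => s j x) := hs.linearIndependent hx
  have hnorm {V : Π q : M, TangentSpace I q} (hV : CMDiffAt ∞ (T% V) x) (h0 : V x ≠ 0) :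
      CMDiffAt ∞ (fun q => ‖V q‖⁻¹) x := by
    have h1 : CMDiffAt ∞ (fun q => (√(inner ℝ (V q) (V q)))⁻¹) x := by
      have h2 : ContDiffAt ℝ ∞ (fun t : ℝ => (√t)⁻¹) (inner ℝ (V x) (V x)) := by
        have h3 : (inner ℝ (V x) (V x) : ℝ) ≠ 0 := inner_self_ne_zero.2 h0
        have h4 : √(inner ℝ (V x) (V x) : ℝ) ≠ 0 := by
          rw [real_inner_self_eq_norm_sq, Real.sqrt_sq (norm_nonneg _)]
          exact norm_ne_zero_iff.2 h0
        exact (Real.contDiffAt_sqrt h3).inv h4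
      exact ContMDiffAt.comp x (g := fun t : ℝ => (√t)⁻¹) h2.contMDiffAt (contMDiffAt_inner hV hV)
    refine h1.congr_of_eventuallyEq (Filter.Eventually.of_forall fun q => ?_)
    simp only [real_inner_self_eq_norm_sq, Real.sqrt_sq (norm_nonneg _)]
  have hg i : CMDiffAt ∞ (T% (g i)) x := by
    induction i using WellFoundedLT.induction with
    | ind i ih =>
      have h1 : CMDiffAt ∞ (T% (fun q => ∑ j ∈ Finset.Iio i,
          ((fun q => (inner ℝ (g j q) (s i q) : ℝ) * (‖g j q‖⁻¹ * ‖g j q‖⁻¹)) • g j) q)) x := by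
        refine ContMDiffAt.sum_section fun j hj => ?_
        have hj' := ih j (Finset.mem_Iio.1 hj)
        have hn := hnorm hj' (InnerProductSpace.gramSchmidt_ne_zero j hli)
        exact ((contMDiffAt_inner hj' (hs1 i)).mul (hn.mul hn)).smul_section hj'
      refine ((hs1 i).sub_section h1).congr_of_eventuallyEq
        (Filter.Eventually.of_forall fun q => congrArg (TotalSpace.mk q) ?_)
      have h2 := InnerProductSpace.gramSchmidt_def'' ℝ (fun j => s j q) i
      refine (eq_sub_of_add_eq h2.symm).trans ?_
      simp only [Pi.sub_apply, Pi.smul_apply', g, div_eq_mul_inv, sq, mul_inv]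
      rfl
  refine ⟨fun i => (fun q => ‖g i q‖⁻¹) • g i, fun i => ?_, ?_⟩
  · exact (hnorm (hg i) (InnerProductSpace.gramSchmidt_ne_zero i hli)).smul_section (hg i)
  · filter_upwards [t.open_baseSet.mem_nhds hx] with q hq
    exact InnerProductSpace.gramSchmidtNormed_orthonormal (hs.linearIndependent hq)

omit [IsManifold I ∞ M] [IsContMDiffRiemannianBundle I ∞ E (fun x : M => TangentSpace I x)] in
theorem exists_orthonormalBasis {e : Fin (Module.finrank ℝ E) → TangentSpace I x}
    (he : Orthonormal ℝ e) :
    ∃ b : OrthonormalBasis (Fin (Module.finrank ℝ E)) ℝ (TangentSpace I x), ⇑b = e := by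
  have : FiniteDimensional ℝ (TangentSpace I x) := inferInstanceAs (FiniteDimensional ℝ E)
  have hc : Fintype.card (Fin (Module.finrank ℝ E)) = Module.finrank ℝ (TangentSpace I x) :=
    Fintype.card_fin _
  exact ⟨OrthonormalBasis.mk he (he.linearIndependent.span_eq_top_of_card_eq_finrank' hc).ge,
    OrthonormalBasis.coe_mk _ _⟩

omit [IsManifold I ∞ M] [IsContMDiffRiemannianBundle I ∞ E (fun x : M => TangentSpace I x)] in
theorem sum_inner_smul {e : Fin (Module.finrank ℝ E) → TangentSpace I x} (he : Orthonormal ℝ e)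
    (v : TangentSpace I x) : ∑ i, (inner ℝ (e i) v : ℝ) • e i = v := by
  obtain ⟨b, rfl⟩ := exists_orthonormalBasis he
  exact b.sum_repr' v

theorem contMDiffAt_koszul (hX : CMDiffAt ∞ (T% X) x) (hY : CMDiffAt ∞ (T% Y) x)
    (hZ : CMDiffAt ∞ (T% Z) x) : CMDiffAt ∞ (koszul X Y Z) x := by
  have := FiniteDimensional.complete ℝ E
  exact ((((contMDiffAt_mvfderiv_apply (contMDiffAt_inner hY hZ) hX).add
    (contMDiffAt_mvfderiv_apply (contMDiffAt_inner hX hZ) hY)).sub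
    (contMDiffAt_mvfderiv_apply (contMDiffAt_inner hX hY) hZ)).add
    (contMDiffAt_inner (contMDiffAt_mlieBracket hX hY) hZ)).sub
    (contMDiffAt_inner (contMDiffAt_mlieBracket hX hZ) hY) |>.sub
    (contMDiffAt_inner (contMDiffAt_mlieBracket hY hZ) hX)

/-- A vector field is smooth if its inner products with smooth vector fields are. -/
theorem contMDiffAt_of_inner (h : ∀ Z : Π x : M, TangentSpace I x, CMDiffAt ∞ (T% Z) x →
    CMDiffAt ∞ (fun q => (inner ℝ (Z q) (X q) : ℝ)) x) : CMDiffAt ∞ (T% X) x := by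
  obtain ⟨e, he, ho⟩ := exists_orthonormal_frame I x
  have h1 : CMDiffAt ∞ (T% (fun q => ∑ i, ((fun q => (inner ℝ (e i q) (X q) : ℝ)) • e i) q)) x :=
    ContMDiffAt.sum_section fun i _ => (h (e i) (he i)).smul_section (he i)
  refine h1.congr_of_eventuallyEq ?_
  filter_upwards [ho] with q hq
  exact congrArg (TotalSpace.mk q) (sum_inner_smul hq (X q)).symm

theorem contMDiffAt_leviCivita (hX : CMDiffAt ∞ (T% X) x) (hY : CMDiffAt ∞ (T% Y) x) :
    CMDiffAt ∞ (T% (fun q => leviCivita I M Y q (X q))) x := by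
  refine contMDiffAt_of_inner fun Z hZ => ?_
  refine (contMDiffAt_const (c := (2 : ℝ)⁻¹) |>.mul
    (contMDiffAt_koszul hX hY hZ)).congr_of_eventuallyEq ?_
  filter_upwards [eventually_mdifferentiableAt hX, eventually_mdifferentiableAt hY,
    eventually_mdifferentiableAt hZ] with q h1 h2 h3
  rw [real_inner_comm]
  exact inner_nabla h1 h2 h3

theorem leviCivita_congr (hX : MDiffAt (T% X) x) (hY : MDiffAt (T% Y) x)
    (h : X =ᶠ[nhds x] Y) : leviCivita I M X x = leviCivita I M Y x :=
  (leviCivita I M).isCovariantDerivativeOnUniv.congr_of_eventuallyEq hX hY Filter.univ_mem h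

end LeviCivitaSmooth

section Curvature

variable {E : Type*} [NormedAddCommGroup E] [NormedSpace ℝ E] [FiniteDimensional ℝ E]
  {H : Type*} [TopologicalSpace H] {I : ModelWithCorners ℝ E H}
  {M : Type*} [TopologicalSpace M] [ChartedSpace H M] [IsManifold I ∞ M]
  [RiemannianBundle (fun x : M => TangentSpace I x)]
  [IsContMDiffRiemannianBundle I ∞ E (fun x : M => TangentSpace I x)]
  {U V W W' Z : Π x : M, TangentSpace I x} {x : M}

/-- The curvature operator `∇_U ∇_V W - ∇_V ∇_U W - ∇_{[U, V]} W` of vector fields. -/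
def fieldCurvature (U V W : Π x : M, TangentSpace I x) (x : M) : TangentSpace I x :=
  leviCivita I M (fun q => leviCivita I M W q (V q)) x (U x)
    - leviCivita I M (fun q => leviCivita I M W q (U q)) x (V x)
    - leviCivita I M W x (mlieBracket I U V x)

theorem curvature_eq_fieldCurvature (u v w : TangentSpace I x) :
    curvature I x u v w = fieldCurvature (extend E u) (extend E v) (extend E w) x := by
  simp only [curvature, fieldCurvature, extend_apply_self]

theorem mvfderiv_mvfderiv_inner (hU : CMDiffAt ∞ (T% U) x) (hV : CMDiffAt ∞ (T% V) x)
    (hW : CMDiffAt ∞ (T% W) x) (hZ : CMDiffAt ∞ (T% Z) x) :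
    d% (fun q => d% (fun p => (inner ℝ (W p) (Z p) : ℝ)) q (V q)) x (U x) =
      inner ℝ (leviCivita I M (fun q => leviCivita I M W q (V q)) x (U x)) (Z x)
        + inner ℝ (leviCivita I M W x (V x)) (leviCivita I M Z x (U x))
        + (inner ℝ (leviCivita I M W x (U x)) (leviCivita I M Z x (V x))
        + inner ℝ (W x) (leviCivita I M (fun q => leviCivita I M Z q (V q)) x (U x))) := by
  have hVW := (contMDiffAt_leviCivita hV hW).mdifferentiableAt (by simp)
  have hVZ := (contMDiffAt_leviCivita hV hZ).mdifferentiableAt (by simp)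
  have hW' := hW.mdifferentiableAt (by simp)
  have hZ' := hZ.mdifferentiableAt (by simp)
  have hU' := hU.mdifferentiableAt (by simp)
  have h : (fun q => d% (fun p => (inner ℝ (W p) (Z p) : ℝ)) q (V q)) =ᶠ[nhds x]
      fun q => inner ℝ (leviCivita I M W q (V q)) (Z q)
        + inner ℝ (W q) (leviCivita I M Z q (V q)) := by
    filter_upwards [eventually_mdifferentiableAt hV, eventually_mdifferentiableAt hW,
      eventually_mdifferentiableAt hZ] with q h1 h2 h3
    exact mvfderiv_inner_leviCivita h1 h2 h3
  rw [mvfderiv_congr h, mvfderiv_fun_add (mdifferentiableAt_inner hVW hZ')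
    (mdifferentiableAt_inner hW' hVZ), add_apply,
    mvfderiv_inner_leviCivita hU' hVW hZ', mvfderiv_inner_leviCivita hU' hW' hVZ]

theorem inner_fieldCurvature (hU : CMDiffAt ∞ (T% U) x) (hV : CMDiffAt ∞ (T% V) x)
    (hW : CMDiffAt ∞ (T% W) x) (hZ : CMDiffAt ∞ (T% Z) x) :
    (inner ℝ (fieldCurvature U V W x) (Z x) : ℝ) = -inner ℝ (W x) (fieldCurvature U V Z x) := by
  have := FiniteDimensional.complete ℝ E
  have h := mvfderiv_mlieBracket (contMDiffAt_inner hW hZ) hU hV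
  rw [mvfderiv_mvfderiv_inner hU hV hW hZ, mvfderiv_mvfderiv_inner hV hU hW hZ,
    mvfderiv_inner_leviCivita ((contMDiffAt_mlieBracket hU hV).mdifferentiableAt (by simp))
      (hW.mdifferentiableAt (by simp)) (hZ.mdifferentiableAt (by simp))] at h
  simp only [fieldCurvature, inner_sub_left, inner_sub_right]
  linarith

/-- The curvature operator depends on the third field only through its value at the point. -/
theorem fieldCurvature_congr (hU : CMDiffAt ∞ (T% U) x) (hV : CMDiffAt ∞ (T% V) x)
    (hW : CMDiffAt ∞ (T% W) x) (hW' : CMDiffAt ∞ (T% W') x) (h : W x = W' x) :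
    fieldCurvature U V W x = fieldCurvature U V W' x := by
  refine ext_inner_right ℝ fun z => ?_
  have hZ : CMDiffAt ∞ (T% (extend E z : Π q : M, TangentSpace I q)) x :=
    contMDiffAt_extend (k := ∞) I E z
  have h1 := inner_fieldCurvature hU hV hW hZ
  have h2 := inner_fieldCurvature hU hV hW' hZ
  rw [h, ← h2] at h1
  simpa using h1

theorem inner_curvature (u v w z : TangentSpace I x) :
    (inner ℝ (curvature I x u v w) z : ℝ) = -inner ℝ w (curvature I x u v z) := by
  have h := inner_fieldCurvature (x := x) (contMDiffAt_extend (k := ∞) I E u)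
    (contMDiffAt_extend (k := ∞) I E v) (contMDiffAt_extend (k := ∞) I E w)
    (contMDiffAt_extend (k := ∞) I E z)
  simpa only [curvature_eq_fieldCurvature, extend_apply_self] using h

/-- A parallel smooth tensor field of type `(1,1)` commutes with the curvature operators. -/
theorem IsParallel.curvature_apply {A : Π x : M, TangentSpace I x →L[ℝ] TangentSpace I x}
    (hA : IsParallel A) (hs : ∀ (Y : Π x : M, TangentSpace I x), CMDiffAt ∞ (T% Y) x →
      CMDiffAt ∞ (T% (fun q => A q (Y q))) x) (u v w : TangentSpace I x) :
    curvature I x u v (A x w) = A x (curvature I x u v w) := by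
  have hU : CMDiffAt ∞ (T% (extend E u : Π q : M, TangentSpace I q)) x :=
    contMDiffAt_extend (k := ∞) I E u
  have hV : CMDiffAt ∞ (T% (extend E v : Π q : M, TangentSpace I q)) x :=
    contMDiffAt_extend (k := ∞) I E v
  have hW : CMDiffAt ∞ (T% (extend E w : Π q : M, TangentSpace I q)) x :=
    contMDiffAt_extend (k := ∞) I E w
  have key {X Y : Π q : M, TangentSpace I q} (hX : CMDiffAt ∞ (T% X) x)
      (hY : CMDiffAt ∞ (T% Y) x) :
      leviCivita I M (fun q => leviCivita I M (fun p => A p (extend E w p)) q (X q)) x (Y x) =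
        A x (leviCivita I M (fun q => leviCivita I M (extend E w) q (X q)) x (Y x)) := by
    have h1 : (fun q => leviCivita I M (fun p => A p (extend E w p)) q (X q)) =ᶠ[nhds x]
        fun q => A q (leviCivita I M (extend E w) q (X q)) := by
      filter_upwards [eventually_mdifferentiableAt hW] with q hq
      exact sub_eq_zero.1 (hA q (X q) _ hq)
    have h2 := contMDiffAt_leviCivita hX hW
    rw [leviCivita_congr ((contMDiffAt_leviCivita hX (hs _ hW)).mdifferentiableAt (by simp))
      ((hs _ h2).mdifferentiableAt (by simp)) h1]
    exact sub_eq_zero.1 (hA x (Y x) _ (h2.mdifferentiableAt (by simp)))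
  rw [curvature_eq_fieldCurvature, curvature_eq_fieldCurvature,
    fieldCurvature_congr hU hV (contMDiffAt_extend (k := ∞) I E (A x w)) (hs _ hW) (by simp)]
  simp only [fieldCurvature]
  rw [key hV hU, key hU hV, map_sub, map_sub,
    sub_eq_zero.1 (hA x _ _ (hW.mdifferentiableAt (by simp)))]

end Curvature

section Pullback

variable {E : Type*} [NormedAddCommGroup E] [NormedSpace ℝ E]
  {H : Type*} [TopologicalSpace H] {I : ModelWithCorners ℝ E H}
  {M : Type*} [TopologicalSpace M] [ChartedSpace H M]
  {E' : Type*} [NormedAddCommGroup E'] [NormedSpace ℝ E'] [FiniteDimensional ℝ E']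
  {H' : Type*} [TopologicalSpace H'] {J : ModelWithCorners ℝ E' H'}
  {N : Type*} [TopologicalSpace N] [ChartedSpace H' N] [IsManifold J ∞ N]
  [RiemannianBundle (fun y : N => TangentSpace J y)]
  [IsContMDiffRiemannianBundle J ∞ E' (fun y : N => TangentSpace J y)]
  {φ : M → N} {p : M} {V W : Π q : M, TangentSpace J (φ q)}

omit [FiniteDimensional ℝ E'] [RiemannianBundle (fun y : N => TangentSpace J y)]
  [IsContMDiffRiemannianBundle J ∞ E' (fun y : N => TangentSpace J y)] in
theorem extend_apply_eq_symmL {y z : N} (v : TangentSpace J y)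
    (hz : z ∈ (trivializationAt E' (TangentSpace J : N → Type _) y).baseSet) :
    (extend E' v : Π z : N, TangentSpace J z) z =
      (trivializationAt E' (TangentSpace J : N → Type _) y).symmL ℝ z
        ((trivializationAt E' (TangentSpace J : N → Type _) y) ⟨y, v⟩).2 := by
  rw [Trivialization.symmL_apply _ hz]
  rfl

omit [FiniteDimensional ℝ E'] [RiemannianBundle (fun y : N => TangentSpace J y)]
  [IsContMDiffRiemannianBundle J ∞ E' (fun y : N => TangentSpace J y)] in
theorem trivialization_add {y z : N}
    (hz : z ∈ (trivializationAt E' (TangentSpace J : N → Type _) y).baseSet)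
    (v w : TangentSpace J z) :
    ((trivializationAt E' (TangentSpace J : N → Type _) y) ⟨z, v + w⟩).2 =
      ((trivializationAt E' (TangentSpace J : N → Type _) y) ⟨z, v⟩).2 +
      ((trivializationAt E' (TangentSpace J : N → Type _) y) ⟨z, w⟩).2 :=
  ((trivializationAt E' (TangentSpace J : N → Type _) y).linear ℝ hz).1 v w

omit [FiniteDimensional ℝ E'] [RiemannianBundle (fun y : N => TangentSpace J y)]
  [IsContMDiffRiemannianBundle J ∞ E' (fun y : N => TangentSpace J y)] in
theorem trivialization_smul {y z : N}
    (hz : z ∈ (trivializationAt E' (TangentSpace J : N → Type _) y).baseSet)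
    (c : ℝ) (v : TangentSpace J z) :
    ((trivializationAt E' (TangentSpace J : N → Type _) y) ⟨z, c • v⟩).2 =
      c • ((trivializationAt E' (TangentSpace J : N → Type _) y) ⟨z, v⟩).2 :=
  ((trivializationAt E' (TangentSpace J : N → Type _) y).linear ℝ hz).2 c v

omit [FiniteDimensional ℝ E'] [RiemannianBundle (fun y : N => TangentSpace J y)]
  [IsContMDiffRiemannianBundle J ∞ E' (fun y : N => TangentSpace J y)] in
theorem eventually_mem_baseSet (hφ : ContinuousAt φ p) :
    ∀ᶠ q in nhds p, φ q ∈ (trivializationAt E' (TangentSpace J : N → Type _) (φ p)).baseSet :=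
  hφ.eventually ((trivializationAt E' (TangentSpace J : N → Type _) (φ p)).open_baseSet.mem_nhds
    (FiberBundle.mem_baseSet_trivializationAt' _))

omit [FiniteDimensional ℝ E'] [RiemannianBundle (fun y : N => TangentSpace J y)]
  [IsContMDiffRiemannianBundle J ∞ E' (fun y : N => TangentSpace J y)] in
theorem extend_add {y : N} (v w : TangentSpace J y) :
    (extend E' (v + w) : Π z : N, TangentSpace J z) =ᶠ[nhds y] extend E' v + extend E' w := by
  filter_upwards [eventually_mem_baseSet (J := J) (φ := fun z : N => z) (p := y) continuousAt_id]
    with z hz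
  simp only [Pi.add_apply, extend_apply_eq_symmL _ hz, ← map_add]
  rw [trivialization_add (FiberBundle.mem_baseSet_trivializationAt' y)]

omit [FiniteDimensional ℝ E'] [RiemannianBundle (fun y : N => TangentSpace J y)]
  [IsContMDiffRiemannianBundle J ∞ E' (fun y : N => TangentSpace J y)] in
theorem extend_smul {y : N} (c : ℝ) (v : TangentSpace J y) :
    (extend E' (c • v) : Π z : N, TangentSpace J z) =ᶠ[nhds y] c • extend E' v := by
  filter_upwards [eventually_mem_baseSet (J := J) (φ := fun z : N => z) (p := y) continuousAt_id]
    with z hz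
  simp only [Pi.smul_apply, extend_apply_eq_symmL _ hz, ← map_smul]
  rw [trivialization_smul (FiberBundle.mem_baseSet_trivializationAt' y)]

theorem pullbackNabla_apply (u : TangentSpace I p) : pullbackNabla I J φ V p u =
    (trivializationAt E' (TangentSpace J : N → Type _) (φ p)).symmL ℝ (φ p)
      (d% (fun q : M => ((trivializationAt E' (TangentSpace J : N → Type _) (φ p))
        ⟨φ q, V q⟩).2) p u)
    + leviCivita J N (extend E' (V p)) (φ p) (mfderiv I J φ p u) :=
  rfl

theorem pullbackNabla_add
    (hV : MDifferentiableAt I J.tangent (fun q => (⟨φ q, V q⟩ : TangentBundle J N)) p)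
    (hW : MDifferentiableAt I J.tangent (fun q => (⟨φ q, W q⟩ : TangentBundle J N)) p) :
    pullbackNabla I J φ (fun q => V q + W q) p =
      pullbackNabla I J φ V p + pullbackNabla I J φ W p := by
  have hV1 := (mdifferentiableAt_totalSpace _ _).1 hV
  have hW1 := (mdifferentiableAt_totalSpace _ _).1 hW
  ext u
  simp only [pullbackNabla_apply, add_apply]
  rw [leviCivita_congr (mdifferentiableAt_extend J E' _) (mdifferentiableAt_add_section
    (mdifferentiableAt_extend J E' _) (mdifferentiableAt_extend J E' _)) (extend_add _ _),
    mvfderiv_congr ((eventually_mem_baseSet hV1.1.continuousAt).mono fun q hq =>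
    trivialization_add hq (V q) (W q)), mvfderiv_fun_add hV1.2 hW1.2,
    (leviCivita J N).isCovariantDerivativeOnUniv.add (mdifferentiableAt_extend J E' _)
    (mdifferentiableAt_extend J E' _)]
  simp only [add_apply, map_add]
  abel

theorem pullbackNabla_smul {f : M → ℝ} (hf : MDiffAt f p)
    (hV : MDifferentiableAt I J.tangent (fun q => (⟨φ q, V q⟩ : TangentBundle J N)) p)
    (u : TangentSpace I p) :
    pullbackNabla I J φ (fun q => f q • V q) p u =
      f p • pullbackNabla I J φ V p u + d% f p u • V p := by
  have hV1 := (mdifferentiableAt_totalSpace _ _).1 hV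
  simp only [pullbackNabla_apply]
  rw [leviCivita_congr (mdifferentiableAt_extend J E' _) (MDifferentiableAt.smul_const_section
    (mdifferentiableAt_extend J E' _)) (extend_smul _ _),
    mvfderiv_congr ((eventually_mem_baseSet hV1.1.continuousAt).mono fun q hq =>
    trivialization_smul hq (f q) (V q)), mvfderiv_fun_smul hf hV1.2,
    (leviCivita J N).isCovariantDerivativeOnUniv.smul_const _ (mdifferentiableAt_extend J E' _)]
  have h1 : (trivializationAt E' (TangentSpace J : N → Type _) (φ p)).symmL ℝ (φ p)
      ((trivializationAt E' (TangentSpace J : N → Type _) (φ p)) ⟨φ p, V p⟩).2 = V p := by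
    rw [← extend_apply_eq_symmL _ (FiberBundle.mem_baseSet_trivializationAt' _), extend_apply_self]
  simp only [add_apply, smul_apply, ContinuousLinearMap.smulRight_apply, map_add, map_smul, h1]
  module

theorem leviCivita_eq_trivialization {S : Π y : N, TangentSpace J y} {y : N}
    (hS : MDiffAt (T% S) y) (v : TangentSpace J y) :
    leviCivita J N S y v =
      (trivializationAt E' (TangentSpace J : N → Type _) y).symmL ℝ y
        (d% (fun z : N => ((trivializationAt E' (TangentSpace J : N → Type _) y) ⟨z, S z⟩).2) y v)
      + leviCivita J N (extend E' (S y)) y v := by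
  have e (X : Π y : N, TangentSpace J y) : pullbackNabla J J (fun z : N => z) X y v =
      (trivializationAt E' (TangentSpace J : N → Type _) y).symmL ℝ y
        (d% (fun z : N => ((trivializationAt E' (TangentSpace J : N → Type _) y) ⟨z, X z⟩).2) y v)
      + leviCivita J N (extend E' (X y)) y v := by
    rw [pullbackNabla_apply]
    congr 2
    exact congrArg (fun L : TangentSpace J y →L[ℝ] TangentSpace J y => L v)
      (mfderiv_id (I := J) (x := y))
  have hT : TensorialAt J E' (fun X : Π y : N, TangentSpace J y =>
      leviCivita J N X y v - pullbackNabla J J (fun z : N => z) X y v) y :=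
    { smul := by
        intro f X hf hX
        have h1 := (leviCivita J N).isCovariantDerivativeOnUniv.leibniz hX hf
        have h2 := pullbackNabla_smul (I := J) (φ := fun z : N => z) hf hX v
        refine (congrArg₂ (· - ·) (congrArg (fun L => L v) h1) h2).trans ?_
        simp only [add_apply, smul_apply, ContinuousLinearMap.smulRight_apply]
        module
      add := by
        intro X X' hX hX'
        have h1 := (leviCivita J N).isCovariantDerivativeOnUniv.add hX hX'
        have h2 := pullbackNabla_add (I := J) (φ := fun z : N => z) hX hX'
        refine (congrArg₂ (· - ·) (congrArg (fun L => L v) h1)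
          (congrArg (fun L => L v) h2)).trans ?_
        simp only [add_apply]
        abel }
  have h := hT.pointwise hS (mdifferentiableAt_extend J E' (S y)) (by simp)
  simp only [e, extend_apply_self] at h
  rw [← sub_eq_zero, h, mvfderiv_congr (g := fun _ => ((trivializationAt E'
    (TangentSpace J : N → Type _) y) ⟨y, S y⟩).2), mvfderiv_const]
  · simp
  · filter_upwards [eventually_mem_baseSet (J := J) (φ := fun z : N => z) (p := y) continuousAt_id]
      with z hz
    rw [extend, Trivialization.apply_mk_symm _ hz]

theorem pullbackNabla_comp {S : Π y : N, TangentSpace J y} (hS : MDiffAt (T% S) (φ p))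
    (hφ : MDiffAt φ p) (u : TangentSpace I p) :
    pullbackNabla I J φ (fun q => S (φ q)) p u =
      leviCivita J N S (φ p) (mfderiv I J φ p u) := by
  rw [leviCivita_eq_trivialization hS, pullbackNabla_apply]
  have hS1 := ((mdifferentiableAt_totalSpace _ _).1 hS).2
  congr 2
  exact congrArg (fun L => L u) (mfderiv_comp p hS1 hφ)

end Pullback

section Frame

variable {E : Type*} [NormedAddCommGroup E] [NormedSpace ℝ E]
  {H : Type*} [TopologicalSpace H] {I : ModelWithCorners ℝ E H}
  {M : Type*} [TopologicalSpace M] [ChartedSpace H M]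
  {E' : Type*} [NormedAddCommGroup E'] [NormedSpace ℝ E'] [FiniteDimensional ℝ E']
  {H' : Type*} [TopologicalSpace H'] {J : ModelWithCorners ℝ E' H'}
  {N : Type*} [TopologicalSpace N] [ChartedSpace H' N] [IsManifold J ∞ N]
  {φ : M → N} {p : M} {V W : Π q : M, TangentSpace J (φ q)}

variable (J) in
/-- The local frame of the tangent bundle given by the preferred trivialization at `y`. -/
def coordFrame (y : N) (i : Fin (Module.finrank ℝ E')) (z : N) : TangentSpace J z :=
  (trivializationAt E' (TangentSpace J : N → Type _) y).symmL ℝ z (Module.finBasis ℝ E' i)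

/-- The coefficients of a vector field along `φ` with respect to `coordFrame J (φ p)`. -/
def coordCoeff (p : M) (V : Π q : M, TangentSpace J (φ q)) (i : Fin (Module.finrank ℝ E'))
    (q : M) : ℝ :=
  (Module.finBasis ℝ E').repr
    ((trivializationAt E' (TangentSpace J : N → Type _) (φ p)) ⟨φ q, V q⟩).2 i

theorem contMDiffAt_coordFrame (y : N) (i : Fin (Module.finrank ℝ E')) :
    CMDiffAt ∞ (T% (coordFrame J y i)) y := by
  rw [contMDiffAt_section]
  refine (contMDiffAt_const (c := Module.finBasis ℝ E' i)).congr_of_eventuallyEq ?_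
  filter_upwards [eventually_mem_baseSet (J := J) (φ := fun z : N => z) (p := y) continuousAt_id]
    with z hz
  rw [coordFrame, Trivialization.symmL_apply _ hz, Trivialization.apply_mk_symm _ hz]

theorem sum_coordCoeff_smul (hφ : ContinuousAt φ p) :
    ∀ᶠ q in nhds p, V q = ∑ i, coordCoeff p V i q • coordFrame J (φ p) i (φ q) := by
  filter_upwards [eventually_mem_baseSet (J := J) hφ] with q hq
  simp only [coordCoeff, coordFrame, ← map_smul, ← map_sum, Module.Basis.sum_repr]
  rw [Trivialization.symmL_apply _ hq]
  exact (Trivialization.symm_proj_apply _ (⟨φ q, V q⟩ : TangentBundle J N) hq).symm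

theorem contMDiffAt_coordCoeff
    (hV : ContMDiffAt I J.tangent ∞ (fun q => (⟨φ q, V q⟩ : TangentBundle J N)) p)
    (i : Fin (Module.finrank ℝ E')) : CMDiffAt ∞ (coordCoeff p V i) p := by
  have h := (Bundle.contMDiffAt_totalSpace.1 hV).2
  have h1 : ContMDiff 𝓘(ℝ, E') 𝓘(ℝ, ℝ) ∞ (fun w => (Module.finBasis ℝ E').repr w i) :=
    (LinearMap.toContinuousLinearMap ((Module.finBasis ℝ E').coord i)).contMDiff
  exact h1.contMDiffAt.comp p h

theorem mdifferentiableAt_coordCoeff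
    (hV : MDifferentiableAt I J.tangent (fun q => (⟨φ q, V q⟩ : TangentBundle J N)) p)
    (i : Fin (Module.finrank ℝ E')) : MDiffAt (coordCoeff p V i) p := by
  have h := ((mdifferentiableAt_totalSpace _ _).1 hV).2
  have h1 : MDifferentiable 𝓘(ℝ, E') 𝓘(ℝ, ℝ) (fun w => (Module.finBasis ℝ E').repr w i) :=
    (LinearMap.toContinuousLinearMap ((Module.finBasis ℝ E').coord i)).mdifferentiable
  exact MDifferentiableAt.comp p h1.mdifferentiableAt h

omit [FiniteDimensional ℝ E'] in
theorem contMDiffAt_along_add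
    (hV : ContMDiffAt I J.tangent ∞ (fun q => (⟨φ q, V q⟩ : TangentBundle J N)) p)
    (hW : ContMDiffAt I J.tangent ∞ (fun q => (⟨φ q, W q⟩ : TangentBundle J N)) p) :
    ContMDiffAt I J.tangent ∞ (fun q => (⟨φ q, V q + W q⟩ : TangentBundle J N)) p := by
  have hV1 := Bundle.contMDiffAt_totalSpace.1 hV
  have hW1 := Bundle.contMDiffAt_totalSpace.1 hW
  refine Bundle.contMDiffAt_totalSpace.2 ⟨hV1.1, (hV1.2.add hW1.2).congr_of_eventuallyEq ?_⟩
  filter_upwards [eventually_mem_baseSet (J := J) hV1.1.continuousAt] with q hq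
  exact trivialization_add hq _ _

omit [FiniteDimensional ℝ E'] in
theorem contMDiffAt_along_smul {f : M → ℝ} (hf : CMDiffAt ∞ f p)
    (hV : ContMDiffAt I J.tangent ∞ (fun q => (⟨φ q, V q⟩ : TangentBundle J N)) p) :
    ContMDiffAt I J.tangent ∞ (fun q => (⟨φ q, f q • V q⟩ : TangentBundle J N)) p := by
  have hV1 := Bundle.contMDiffAt_totalSpace.1 hV
  refine Bundle.contMDiffAt_totalSpace.2 ⟨hV1.1, (hf.smul hV1.2).congr_of_eventuallyEq ?_⟩
  filter_upwards [eventually_mem_baseSet (J := J) hV1.1.continuousAt] with q hq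
  exact trivialization_smul hq _ _

omit [FiniteDimensional ℝ E'] in
theorem contMDiffAt_along_zero (hφ : CMDiffAt ∞ φ p) :
    ContMDiffAt I J.tangent ∞ (fun q => (⟨φ q, 0⟩ : TangentBundle J N)) p :=
  ContMDiffAt.comp p (Bundle.contMDiff_zeroSection ℝ (TangentSpace J : N → Type _)).contMDiffAt hφ

omit [FiniteDimensional ℝ E'] in
theorem contMDiffAt_along_sum {ι : Type*} (s : Finset ι)
    {V : ι → Π q : M, TangentSpace J (φ q)} (hφ : CMDiffAt ∞ φ p)
    (hV : ∀ i, ContMDiffAt I J.tangent ∞ (fun q => (⟨φ q, V i q⟩ : TangentBundle J N)) p) :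
    ContMDiffAt I J.tangent ∞ (fun q => (⟨φ q, ∑ i ∈ s, V i q⟩ : TangentBundle J N)) p := by
  classical
  induction s using Finset.induction_on with
  | empty => simpa using contMDiffAt_along_zero hφ
  | insert a s ha ih => simpa [Finset.sum_insert ha] using contMDiffAt_along_add (hV a) ih

omit [FiniteDimensional ℝ E'] in
theorem mdifferentiableAt_along_add
    (hV : MDifferentiableAt I J.tangent (fun q => (⟨φ q, V q⟩ : TangentBundle J N)) p)
    (hW : MDifferentiableAt I J.tangent (fun q => (⟨φ q, W q⟩ : TangentBundle J N)) p) :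
    MDifferentiableAt I J.tangent (fun q => (⟨φ q, V q + W q⟩ : TangentBundle J N)) p := by
  have hV1 := (mdifferentiableAt_totalSpace _ _).1 hV
  have hW1 := (mdifferentiableAt_totalSpace _ _).1 hW
  refine (mdifferentiableAt_totalSpace _ _).2
    ⟨hV1.1, (hV1.2.add hW1.2).congr_of_eventuallyEq ?_⟩
  filter_upwards [eventually_mem_baseSet (J := J) hV1.1.continuousAt] with q hq
  exact trivialization_add hq _ _

omit [FiniteDimensional ℝ E'] in
theorem mdifferentiableAt_along_smul {f : M → ℝ} (hf : MDiffAt f p)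
    (hV : MDifferentiableAt I J.tangent (fun q => (⟨φ q, V q⟩ : TangentBundle J N)) p) :
    MDifferentiableAt I J.tangent (fun q => (⟨φ q, f q • V q⟩ : TangentBundle J N)) p := by
  have hV1 := (mdifferentiableAt_totalSpace _ _).1 hV
  refine (mdifferentiableAt_totalSpace _ _).2 ⟨hV1.1, (hf.smul hV1.2).congr_of_eventuallyEq ?_⟩
  filter_upwards [eventually_mem_baseSet (J := J) hV1.1.continuousAt] with q hq
  exact trivialization_smul hq _ _

omit [FiniteDimensional ℝ E'] in
theorem mdifferentiableAt_along_zero (hφ : MDiffAt φ p) :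
    MDifferentiableAt I J.tangent (fun q => (⟨φ q, 0⟩ : TangentBundle J N)) p :=
  MDifferentiableAt.comp p
    (mdifferentiableAt_zeroSection ℝ (TangentSpace J : N → Type _)) hφ

omit [FiniteDimensional ℝ E'] in
theorem mdifferentiableAt_along_sum {ι : Type*} (s : Finset ι)
    {V : ι → Π q : M, TangentSpace J (φ q)} (hφ : MDiffAt φ p)
    (hV : ∀ i, MDifferentiableAt I J.tangent (fun q => (⟨φ q, V i q⟩ : TangentBundle J N)) p) :
    MDifferentiableAt I J.tangent (fun q => (⟨φ q, ∑ i ∈ s, V i q⟩ : TangentBundle J N)) p := by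
  classical
  induction s using Finset.induction_on with
  | empty => simpa using mdifferentiableAt_along_zero hφ
  | insert a s ha ih => simpa [Finset.sum_insert ha] using mdifferentiableAt_along_add (hV a) ih

theorem mdifferentiableAt_sum {ι : Type*} (s : Finset ι) {f : ι → M → ℝ}
    (hf : ∀ i, MDiffAt (f i) p) : MDiffAt (fun q => ∑ i ∈ s, f i q) p := by
  classical
  induction s using Finset.induction_on with
  | empty => simpa using mdifferentiableAt_const
  | insert a s ha ih =>
    simp only [Finset.sum_insert ha]
    exact (hf a).add ih

theorem mvfderiv_sum {ι : Type*} (s : Finset ι) {f : ι → M → ℝ} (hf : ∀ i, MDiffAt (f i) p)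
    (v : TangentSpace I p) : d% (fun q => ∑ i ∈ s, f i q) p v = ∑ i ∈ s, d% (f i) p v := by
  classical
  induction s using Finset.induction_on with
  | empty => simp [mvfderiv_const]
  | insert a s ha ih =>
    have h : MDiffAt (fun q => ∑ i ∈ s, f i q) p := mdifferentiableAt_sum s hf
    simp only [Finset.sum_insert ha]
    rw [mvfderiv_fun_add (hf a) h, add_apply, ih]

variable [RiemannianBundle (fun y : N => TangentSpace J y)]
  [IsContMDiffRiemannianBundle J ∞ E' (fun y : N => TangentSpace J y)]

theorem pullbackNabla_congr (h : ∀ᶠ q in nhds p, V q = W q) :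
    pullbackNabla I J φ V p = pullbackNabla I J φ W p := by
  ext u
  rw [pullbackNabla_apply, pullbackNabla_apply, h.self_of_nhds,
    mvfderiv_congr (h.mono fun q hq => by rw [hq])]

theorem pullbackNabla_sum {ι : Type*} (s : Finset ι)
    {V : ι → Π q : M, TangentSpace J (φ q)} (hφ : MDiffAt φ p)
    (hV : ∀ i, MDifferentiableAt I J.tangent (fun q => (⟨φ q, V i q⟩ : TangentBundle J N)) p) :
    pullbackNabla I J φ (fun q => ∑ i ∈ s, V i q) p = ∑ i ∈ s, pullbackNabla I J φ (V i) p := by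
  classical
  induction s using Finset.induction_on with
  | empty =>
    have h := pullbackNabla_add (mdifferentiableAt_along_zero (J := J) hφ)
      (mdifferentiableAt_along_zero (J := J) hφ)
    simp only [add_zero] at h
    simpa using h
  | insert a s ha ih =>
    simp only [Finset.sum_insert ha]
    rw [← ih]
    exact pullbackNabla_add (hV a) (mdifferentiableAt_along_sum s hφ hV)

theorem pullbackNabla_sum_smul {ι : Type*} (s : Finset ι) {c : ι → M → ℝ}
    {S : ι → Π y : N, TangentSpace J y} (hφ : MDiffAt φ p) (hc : ∀ i, MDiffAt (c i) p)
    (hS : ∀ i, MDiffAt (T% (S i)) (φ p))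
    (h : ∀ᶠ q in nhds p, V q = ∑ i ∈ s, c i q • S i (φ q)) (u : TangentSpace I p) :
    pullbackNabla I J φ V p u = ∑ i ∈ s,
      (c i p • leviCivita J N (S i) (φ p) (mfderiv I J φ p u) + d% (c i) p u • S i (φ p)) := by
  have hS' i : MDifferentiableAt I J.tangent (fun q => (⟨φ q, S i (φ q)⟩ : TangentBundle J N)) p :=
    MDifferentiableAt.comp p (hS i) hφ
  rw [pullbackNabla_congr h, pullbackNabla_sum s hφ fun i =>
    mdifferentiableAt_along_smul (hc i) (hS' i), sum_apply]
  refine Finset.sum_congr rfl fun i _ => ?_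
  rw [pullbackNabla_smul (hc i) (hS' i), pullbackNabla_comp (hS i) hφ]

/-- The covariant derivative of a smooth vector field along `φ` in the direction of a smooth
vector field is smooth along `φ`. -/
theorem contMDiffAt_pullbackNabla [IsManifold I ∞ M] {X : Π q : M, TangentSpace I q}
    (hV : ContMDiffAt I J.tangent ∞ (fun q => (⟨φ q, V q⟩ : TangentBundle J N)) p)
    (hX : CMDiffAt ∞ (T% X) p) :
    ContMDiffAt I J.tangent ∞
      (fun q => (⟨φ q, pullbackNabla I J φ V q (X q)⟩ : TangentBundle J N)) p := by
  have hφ : CMDiffAt ∞ φ p := (Bundle.contMDiffAt_totalSpace.1 hV).1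
  have hc := contMDiffAt_coordCoeff hV
  have hs := contMDiffAt_coordFrame (J := J) (φ p)
  have hX' := contMDiffAt_mfderiv_apply hφ hX
  have hd := contMDiffAt_coordCoeff hX'
  have h1 : ∀ᶠ q in nhds p, pullbackNabla I J φ V q (X q) = ∑ i,
      (coordCoeff p V i q • (∑ j, coordCoeff p (fun q => mfderiv I J φ q (X q)) j q •
          leviCivita J N (coordFrame J (φ p) i) (φ q) (coordFrame J (φ p) j (φ q)))
        + d% (coordCoeff p V i) q (X q) • coordFrame J (φ p) i (φ q)) := by
    filter_upwards [eventually_mdifferentiableAt hφ,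
      Filter.eventually_all.2 fun i => eventually_mdifferentiableAt (hc i),
      hφ.continuousAt.eventually
        (Filter.eventually_all.2 fun i => eventually_mdifferentiableAt (hs i)),
      (sum_coordCoeff_smul (V := V) hφ.continuousAt).eventually_nhds,
      sum_coordCoeff_smul (V := fun q => mfderiv I J φ q (X q)) hφ.continuousAt]
      with q h1 h2 h3 h4 h5
    rw [pullbackNabla_sum_smul Finset.univ h1 h2 h3 h4]
    refine Finset.sum_congr rfl fun i _ => ?_
    simp only [← map_smul, ← map_sum, ← h5]
  have h2 := contMDiffAt_along_sum (J := J) Finset.univ hφ fun i => contMDiffAt_along_add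
    (contMDiffAt_along_smul (hc i) (contMDiffAt_along_sum (J := J) Finset.univ hφ fun j =>
      contMDiffAt_along_smul (hd j)
        (ContMDiffAt.comp p (contMDiffAt_leviCivita (hs j) (hs i)) hφ)))
    (contMDiffAt_along_smul (contMDiffAt_mvfderiv_apply (hc i) hX)
      (ContMDiffAt.comp p (hs i) hφ))
  exact h2.congr_of_eventuallyEq (h1.mono fun q hq => congrArg (TotalSpace.mk (φ q)) hq)

/-- The covariant Hessian of `h` at `y`, as the tensorial operation
`S ↦ v (dh S) - dh (∇_v S)` on vector fields. -/
theorem tensorial_hessian {h : N → ℝ} {y : N} (hh : CMDiffAt ∞ h y) (v : TangentSpace J y) :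
    TensorialAt J E' (fun S : Π z : N, TangentSpace J z =>
      d% (fun z => d% h z (S z)) y v - d% h y (leviCivita J N S y v)) y where
  smul {f S} hf hS := by
    have h1 : MDiffAt (fun z => d% h z (S z)) y := mdifferentiableAt_mvfderiv_apply hh hS
    have h2 : (fun z => d% h z ((f • S) z)) = fun z => f z * d% h z (S z) := by
      ext z; simp
    have h3 := congrArg (fun L => L v) <|
      (leviCivita J N).isCovariantDerivativeOnUniv.leibniz hS hf
    simp only [add_apply, smul_apply, ContinuousLinearMap.smulRight_apply] at h3
    rw [h2, mvfderiv_fun_mul hf h1]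
    refine (congrArg (fun w => _ - d% h y w) h3).trans ?_
    simp
    ring
  add {S S'} hS hS' := by
    have h1 : MDiffAt (fun z => d% h z (S z)) y := mdifferentiableAt_mvfderiv_apply hh hS
    have h1' : MDiffAt (fun z => d% h z (S' z)) y := mdifferentiableAt_mvfderiv_apply hh hS'
    have h2 : (fun z => d% h z ((S + S') z)) = fun z => d% h z (S z) + d% h z (S' z) := by
      ext z; simp
    have h3 := congrArg (fun L => L v) <|
      (leviCivita J N).isCovariantDerivativeOnUniv.add hS hS'
    simp only [add_apply] at h3
    rw [h2, mvfderiv_fun_add h1 h1']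
    refine (congrArg (fun w => _ - d% h y w) h3).trans ?_
    simp
    ring

end Frame

section Torsion

variable {E : Type*} [NormedAddCommGroup E] [NormedSpace ℝ E] [FiniteDimensional ℝ E]
  {H : Type*} [TopologicalSpace H] {I : ModelWithCorners ℝ E H}
  {M : Type*} [TopologicalSpace M] [ChartedSpace H M] [IsManifold I ∞ M]
  {E' : Type*} [NormedAddCommGroup E'] [NormedSpace ℝ E'] [FiniteDimensional ℝ E']
  {H' : Type*} [TopologicalSpace H'] {J : ModelWithCorners ℝ E' H'}
  {N : Type*} [TopologicalSpace N] [ChartedSpace H' N] [IsManifold J ∞ N]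
  [RiemannianBundle (fun y : N => TangentSpace J y)]
  [IsContMDiffRiemannianBundle J ∞ E' (fun y : N => TangentSpace J y)]
  {φ : M → N} {p : M}

omit [FiniteDimensional ℝ E] [IsManifold I ∞ M] in
theorem mvfderiv_mvfderiv_along {V : Π q : M, TangentSpace J (φ q)} {S : Π y : N, TangentSpace J y}
    {h : N → ℝ} (hh : CMDiffAt ∞ h (φ p))
    (hV : MDifferentiableAt I J.tangent (fun q => (⟨φ q, V q⟩ : TangentBundle J N)) p)
    (hS : MDiffAt (T% S) (φ p)) (hSV : S (φ p) = V p) (u : TangentSpace I p) :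
    d% (fun q => d% h (φ q) (V q)) p u - d% h (φ p) (pullbackNabla I J φ V p u) =
      d% (fun z => d% h z (S z)) (φ p) (mfderiv I J φ p u)
        - d% h (φ p) (leviCivita J N S (φ p) (mfderiv I J φ p u)) := by
  have hφ : MDiffAt φ p := ((mdifferentiableAt_totalSpace _ _).1 hV).1
  have hc := mdifferentiableAt_coordCoeff hV
  have hs i := (contMDiffAt_coordFrame (J := J) (φ p) i).mdifferentiableAt (by simp)
  have hsum := sum_coordCoeff_smul (V := V) hφ.continuousAt
  have hT := tensorial_hessian hh (mfderiv I J φ p u)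
  have hg i : MDiffAt (fun z => d% h z (coordFrame J (φ p) i z)) (φ p) :=
    mdifferentiableAt_mvfderiv_apply hh (hs i)
  have hg' i : MDiffAt (fun q => d% h (φ q) (coordFrame J (φ p) i (φ q))) p :=
    MDifferentiableAt.comp p (hg i) hφ
  have h1 : d% (fun q => d% h (φ q) (V q)) p u = ∑ i, (coordCoeff p V i p *
      d% (fun z => d% h z (coordFrame J (φ p) i z)) (φ p) (mfderiv I J φ p u) +
      d% (coordCoeff p V i) p u * d% h (φ p) (coordFrame J (φ p) i (φ p))) := by
    have e : (fun q => d% h (φ q) (V q)) =ᶠ[nhds p] fun q => ∑ i, coordCoeff p V i q *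
        d% h (φ q) (coordFrame J (φ p) i (φ q)) :=
      hsum.mono fun q hq => by
        simp only
        conv_lhs => rw [hq]
        simp
    rw [mvfderiv_congr e, mvfderiv_sum (f := fun i q => coordCoeff p V i q *
      d% h (φ q) (coordFrame J (φ p) i (φ q))) _ fun i => (hc i).mul (hg' i)]
    refine Finset.sum_congr rfl fun i _ => ?_
    have e2 := mvfderiv_comp_apply (g := fun z => d% h z (coordFrame J (φ p) i z)) p (hg i) hφ u
    rw [mvfderiv_fun_mul (hc i) (hg' i)]
    simp only [add_apply, smul_apply, smul_eq_mul, ← e2, Function.comp_def]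
    ring
  rw [h1, pullbackNabla_sum_smul Finset.univ hφ hc hs hsum u, map_sum, ← Finset.sum_sub_distrib]
  have h2 := TensorialAt.mkHom_apply hT hS
  have h3 i := TensorialAt.mkHom_apply hT (hs i)
  refine Eq.trans ?_ h2
  rw [hSV, hsum.self_of_nhds, map_sum]
  refine Finset.sum_congr rfl fun i _ => ?_
  rw [map_smul, h3]
  simp
  ring

omit [FiniteDimensional ℝ E'] [RiemannianBundle (fun y : N => TangentSpace J y)]
  [IsContMDiffRiemannianBundle J ∞ E' (fun y : N => TangentSpace J y)] in
/-- Smooth functions separate tangent vectors. -/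
theorem eq_of_mvfderiv_eq [FiniteDimensional ℝ E'] {y : N} {v w : TangentSpace J y}
    (h : ∀ f : N → ℝ, CMDiffAt ∞ f y → d% f y v = d% f y w) : v = w := by
  have hinj := (isInvertible_mfderiv_extChartAt (I := J)
    (mem_extChartAt_source (I := J) y)).injective
  refine hinj ?_
  have hd : MDifferentiableAt J 𝓘(ℝ, E') (extChartAt J y) y :=
    (contMDiffAt_extChartAt (n := 1)).mdifferentiableAt one_ne_zero
  refine (SeparatingDual.eq_iff_forall_dual_eq (R := ℝ) (V := E')).2 fun ℓ => ?_
  have h1 := h (ℓ ∘ extChartAt J y) (ℓ.contMDiff.contMDiffAt.comp y contMDiffAt_extChartAt)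
  have hℓ : MDifferentiableAt 𝓘(ℝ, E') 𝓘(ℝ, ℝ) ℓ (extChartAt J y y) := ℓ.mdifferentiableAt
  rw [mvfderiv_comp_apply y hℓ hd, mvfderiv_comp_apply y hℓ hd] at h1
  simp only [mvfderiv, ContinuousLinearMap.mfderiv_eq] at h1
  exact h1

/-- The pulled back Levi-Civita connection is torsion-free. -/
theorem pullbackNabla_sub_pullbackNabla {X Y : Π q : M, TangentSpace I q}
    (hφ : CMDiffAt ∞ φ p) (hX : CMDiffAt ∞ (T% X) p) (hY : CMDiffAt ∞ (T% Y) p) :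
    pullbackNabla I J φ (fun q => mfderiv I J φ q (Y q)) p (X p)
      - pullbackNabla I J φ (fun q => mfderiv I J φ q (X q)) p (Y p)
      = mfderiv I J φ p (mlieBracket I X Y p) := by
  have := FiniteDimensional.complete ℝ E
  have := FiniteDimensional.complete ℝ E'
  refine eq_of_mvfderiv_eq fun h hh => ?_
  set R : Π y : N, TangentSpace J y := extend E' (mfderiv I J φ p (X p))
  set S : Π y : N, TangentSpace J y := extend E' (mfderiv I J φ p (Y p))
  have hR : CMDiffAt ∞ (T% R) (φ p) := contMDiffAt_extend (k := ∞) J E' _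
  have hS : CMDiffAt ∞ (T% S) (φ p) := contMDiffAt_extend (k := ∞) J E' _
  have hRp : R (φ p) = mfderiv I J φ p (X p) := extend_apply_self _ _
  have hSp : S (φ p) = mfderiv I J φ p (Y p) := extend_apply_self _ _
  have h1 := mvfderiv_mvfderiv_along hh
    (mdifferentiableAt_mfderiv_apply hφ (hY.mdifferentiableAt (by simp)))
    (hS.mdifferentiableAt (by simp)) hSp (X p)
  have h2 := mvfderiv_mvfderiv_along hh
    (mdifferentiableAt_mfderiv_apply hφ (hX.mdifferentiableAt (by simp)))
    (hR.mdifferentiableAt (by simp)) hRp (Y p)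
  have h3 := mvfderiv_mlieBracket hh hR hS
  have h4 := (CovariantDerivative.torsion_eq_zero_iff _).1 (torsion_leviCivita (I := J) (M := N))
    (hR.mdifferentiableAt (by simp)) (hS.mdifferentiableAt (by simp))
  have hcomp : ContMDiffAt I 𝓘(ℝ, ℝ) ∞ (h ∘ φ) p := hh.comp p hφ
  have h5 := mvfderiv_mlieBracket hcomp hX hY
  have key (Z : Π q : M, TangentSpace I q) : (fun q => d% (h ∘ φ) q (Z q)) =ᶠ[nhds p]
      fun q => d% h (φ q) (mfderiv I J φ q (Z q)) := by
    filter_upwards [eventually_mdifferentiableAt hφ,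
      hφ.continuousAt.eventually (eventually_mdifferentiableAt hh)] with q e1 e2
    exact mvfderiv_comp_apply q e2 e1 _
  rw [mvfderiv_congr (key Y), mvfderiv_congr (key X), mvfderiv_comp_apply p
    (hh.mdifferentiableAt (by simp)) (hφ.mdifferentiableAt (by simp))] at h5
  rw [← hRp] at h1
  rw [← hSp] at h2
  rw [← h4, map_sub] at h3
  rw [map_sub]
  linarith

end Torsion

section SecondFundamentalForm

variable {E : Type*} [NormedAddCommGroup E] [NormedSpace ℝ E] [FiniteDimensional ℝ E]
  {H : Type*} [TopologicalSpace H] {I : ModelWithCorners ℝ E H}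
  {M : Type*} [TopologicalSpace M] [ChartedSpace H M] [IsManifold I ∞ M]
  [RiemannianBundle (fun x : M => TangentSpace I x)]
  [IsContMDiffRiemannianBundle I ∞ E (fun x : M => TangentSpace I x)]
  {E' : Type*} [NormedAddCommGroup E'] [NormedSpace ℝ E'] [FiniteDimensional ℝ E']
  {H' : Type*} [TopologicalSpace H'] {J : ModelWithCorners ℝ E' H'}
  {N : Type*} [TopologicalSpace N] [ChartedSpace H' N] [IsManifold J ∞ N]
  [RiemannianBundle (fun y : N => TangentSpace J y)]
  [IsContMDiffRiemannianBundle J ∞ E' (fun y : N => TangentSpace J y)]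
  {φ : M → N} {p : M} {X Y : Π q : M, TangentSpace I q}

/-- The Gauss formula, for arbitrary differentiable vector fields. -/
theorem secondFundamentalForm_apply (hφ : CMDiffAt ∞ φ p) (hY : MDiffAt (T% Y) p)
    (u : TangentSpace I p) : secondFundamentalForm I J φ p (Y p) u =
      pullbackNabla I J φ (fun q => mfderiv I J φ q (Y q)) p u
        - mfderiv I J φ p (leviCivita I M Y p u) := by
  have hT : TensorialAt I E (fun Y : Π q : M, TangentSpace I q =>
      pullbackNabla I J φ (fun q => mfderiv I J φ q (Y q)) p u
        - mfderiv I J φ p (leviCivita I M Y p u)) p :=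
    { smul := by
        intro f X hf hX
        have h1 := congrArg (fun L => L u)
          ((leviCivita I M).isCovariantDerivativeOnUniv.leibniz hX hf)
        have h2 := pullbackNabla_smul hf (mdifferentiableAt_mfderiv_apply (J := J) hφ hX) u
        have e : (fun q => mfderiv I J φ q ((f • X) q)) =
            fun q => f q • mfderiv I J φ q (X q) := by ext q; simp
        rw [e, h2]
        refine (congrArg (fun w => _ - mfderiv I J φ p w) h1).trans ?_
        simp only [add_apply, smul_apply, ContinuousLinearMap.smulRight_apply, map_add, map_smul]
        module
      add := by
        intro X X' hX hX'
        have h1 := congrArg (fun L => L u)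
          ((leviCivita I M).isCovariantDerivativeOnUniv.add hX hX')
        have h2 := pullbackNabla_add (mdifferentiableAt_mfderiv_apply (J := J) hφ hX)
          (mdifferentiableAt_mfderiv_apply (J := J) hφ hX')
        have e : (fun q => mfderiv I J φ q ((X + X') q)) =
            fun q => mfderiv I J φ q (X q) + mfderiv I J φ q (X' q) := by ext q; simp
        rw [e, h2]
        refine (congrArg (fun w => _ - mfderiv I J φ p w) h1).trans ?_
        simp only [add_apply, map_add]
        abel }
  exact hT.pointwise (mdifferentiableAt_extend I E (Y p)) hY (by simp)

theorem secondFundamentalForm_symm (hφ : CMDiffAt ∞ φ p) (u v : TangentSpace I p) :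
    secondFundamentalForm I J φ p u v = secondFundamentalForm I J φ p v u := by
  have hU : CMDiffAt ∞ (T% (extend E u : Π q : M, TangentSpace I q)) p :=
    contMDiffAt_extend (k := ∞) I E u
  have hV : CMDiffAt ∞ (T% (extend E v : Π q : M, TangentSpace I q)) p :=
    contMDiffAt_extend (k := ∞) I E v
  have h1 := secondFundamentalForm_apply (J := J) hφ (hU.mdifferentiableAt (by simp)) v
  have h2 := secondFundamentalForm_apply (J := J) hφ (hV.mdifferentiableAt (by simp)) u
  have h3 := pullbackNabla_sub_pullbackNabla (J := J) hφ hV hU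
  have h4 := (CovariantDerivative.torsion_eq_zero_iff _).1 (torsion_leviCivita (I := I) (M := M))
    (hV.mdifferentiableAt (by simp)) (hU.mdifferentiableAt (by simp))
  rw [← h4, map_sub] at h3
  simp only [extend_apply_self] at h1 h2 h3
  rw [h1, h2, ← sub_eq_zero]
  rw [← sub_eq_zero] at h3
  rw [← h3]
  abel

theorem contMDiffAt_secondFundamentalForm (hφ : CMDiffAt ∞ φ p) (hX : CMDiffAt ∞ (T% X) p)
    (hY : CMDiffAt ∞ (T% Y) p) (hφ' : ∀ᶠ q in nhds p, CMDiffAt ∞ φ q) :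
    ContMDiffAt I J.tangent ∞
      (fun q => (⟨φ q, secondFundamentalForm I J φ q (Y q) (X q)⟩ : TangentBundle J N)) p := by
  have h1 := contMDiffAt_pullbackNabla (contMDiffAt_mfderiv_apply (J := J) hφ hY) hX
  have h2 := contMDiffAt_mfderiv_apply (J := J) hφ (contMDiffAt_leviCivita hX hY)
  have h3 := contMDiffAt_along_add h1
    (contMDiffAt_along_smul (contMDiffAt_const (c := (-1 : ℝ))) h2)
  refine h3.congr_of_eventuallyEq ?_
  filter_upwards [hφ', eventually_mdifferentiableAt hY] with q h4 h5
  rw [secondFundamentalForm_apply h4 h5, neg_one_smul, sub_eq_add_neg]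

theorem inner_shapeOperator (hφ : CMDiffAt ∞ φ p) (ξ : TangentSpace J (φ p))
    (u v : TangentSpace I p) : (inner ℝ (shapeOperator I J φ p ξ u) v : ℝ) =
      inner ℝ (secondFundamentalForm I J φ p u v) ξ := by
  rw [real_inner_comm ξ]
  conv_rhs => rw [← (tangentBasis I p).sum_repr' v]
  simp only [shapeOperator, sum_apply, sum_inner, map_sum, inner_sum, map_smul, inner_smul_right,
    ContinuousLinearMap.smulRight_apply, inner_smul_left, ContinuousLinearMap.comp_apply,
    innerSL_apply_apply]
  refine Finset.sum_congr rfl fun i _ => ?_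
  rw [secondFundamentalForm_symm hφ]
  simp [mul_comm]

theorem trace_shapeOperator (hφ : CMDiffAt ∞ φ p) (ξ : TangentSpace J (φ p))
    (b : OrthonormalBasis (Fin (Module.finrank ℝ E)) ℝ (TangentSpace I p)) :
    LinearMap.trace ℝ (TangentSpace I p) (shapeOperator I J φ p ξ).toLinearMap =
      inner ℝ (∑ i, secondFundamentalForm I J φ p (b i) (b i)) ξ := by
  rw [LinearMap.trace_eq_sum_inner _ b, sum_inner]
  refine Finset.sum_congr rfl fun i _ => ?_
  rw [real_inner_comm]
  exact inner_shapeOperator hφ ξ _ _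

theorem meanCurvature_eq (hφ : CMDiffAt ∞ φ p)
    (b : OrthonormalBasis (Fin (Module.finrank ℝ E)) ℝ (TangentSpace I p)) :
    meanCurvature I J φ p = (Module.finrank ℝ E : ℝ)⁻¹ •
      ∑ i, secondFundamentalForm I J φ p (b i) (b i) := by
  rw [meanCurvature]
  congr 1
  refine ext_inner_right ℝ fun ξ => ?_
  rw [← trace_shapeOperator hφ ξ, ← trace_shapeOperator hφ ξ]

theorem contMDiffAt_meanCurvature (hφ : ContMDiff I J ∞ φ) :
    ContMDiffAt I J.tangent ∞
      (fun q => (⟨φ q, meanCurvature I J φ q⟩ : TangentBundle J N)) p := by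
  obtain ⟨e, he, ho⟩ := exists_orthonormal_frame I p
  have h := contMDiffAt_along_smul
    (contMDiffAt_const (c := (Module.finrank ℝ E : ℝ)⁻¹))
    (contMDiffAt_along_sum (J := J) Finset.univ hφ.contMDiffAt fun i =>
      contMDiffAt_secondFundamentalForm hφ.contMDiffAt (he i) (he i)
        (Filter.Eventually.of_forall fun q => hφ.contMDiffAt))
  refine h.congr_of_eventuallyEq ?_
  filter_upwards [ho] with q hq
  obtain ⟨b, hb⟩ := exists_orthonormalBasis hq
  rw [meanCurvature_eq hφ.contMDiffAt b, hb]

theorem contMDiffAt_shapeOperatorH (hφ : ContMDiff I J ∞ φ) (hX : CMDiffAt ∞ (T% X) p) :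
    CMDiffAt ∞ (T% (fun q => shapeOperatorH I J φ q (X q))) p := by
  refine contMDiffAt_of_inner fun Z hZ => ?_
  have h : CMDiffAt ∞ (fun q => (inner ℝ (secondFundamentalForm I J φ q (X q) (Z q))
      (meanCurvature I J φ q) : ℝ)) p :=
    ContMDiffAt.inner_bundle (IB := J) (IM := I) (b := φ) (B := N) (F := E')
      (E := fun y : N => TangentSpace J y)
      (contMDiffAt_secondFundamentalForm hφ.contMDiffAt hZ hX
        (Filter.Eventually.of_forall fun q => hφ.contMDiffAt))
      (contMDiffAt_meanCurvature hφ)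
  refine h.congr_of_eventuallyEq (Filter.Eventually.of_forall fun q => ?_)
  simp only
  rw [real_inner_comm, shapeOperatorH, inner_shapeOperator hφ.contMDiffAt]

theorem inner_shapeOperatorH_comm (hφ : ContMDiff I J ∞ φ) (u v : TangentSpace I p) :
    (inner ℝ (shapeOperatorH I J φ p u) v : ℝ) = inner ℝ u (shapeOperatorH I J φ p v) := by
  rw [← real_inner_comm u, shapeOperatorH, inner_shapeOperator hφ.contMDiffAt,
    inner_shapeOperator hφ.contMDiffAt, secondFundamentalForm_symm hφ.contMDiffAt]

theorem trace_shapeOperatorH (hE : Module.finrank ℝ E ≠ 0) (hφ : ContMDiff I J ∞ φ) :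
    LinearMap.trace ℝ (TangentSpace I p) (shapeOperatorH I J φ p).toLinearMap =
      Module.finrank ℝ E * ‖meanCurvature I J φ p‖ ^ 2 := by
  rw [shapeOperatorH, trace_shapeOperator hφ.contMDiffAt _ (tangentBasis I p),
    ← real_inner_self_eq_norm_sq]
  nth_rw 2 [meanCurvature]
  rw [real_inner_smul_left]
  field_simp

end SecondFundamentalForm

section Parallel

variable {E : Type*} [NormedAddCommGroup E] [NormedSpace ℝ E]
  {H : Type*} [TopologicalSpace H] {I : ModelWithCorners ℝ E H}
  {M : Type*} [TopologicalSpace M] [ChartedSpace H M] [IsManifold I ∞ M]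

/-- A function with vanishing derivative on a manifold without boundary is locally constant. -/
theorem isLocallyConstant_of_mvfderiv_eq_zero [I.Boundaryless] {f : M → ℝ} (hf : MDiff f)
    (h : ∀ x, d% f x = 0) : IsLocallyConstant f := by
  refine (IsLocallyConstant.iff_eventually_eq f).2 fun x => ?_
  set ψ := extChartAt I x
  have ht : IsOpen ψ.target := isOpen_extChartAt_target x
  have hder (y : E) (hy : y ∈ ψ.target) :
      HasFDerivAt (f ∘ ψ.symm) (0 : E →L[ℝ] ℝ) y := by
    have h1 : MDifferentiableAt 𝓘(ℝ, E) I ψ.symm y :=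
      (mdifferentiableOn_extChartAt_symm y hy).mdifferentiableAt (ht.mem_nhds hy)
    have h2 := (hf (ψ.symm y)).hasMFDerivAt.comp y h1.hasMFDerivAt
    have h3 : mfderiv I 𝓘(ℝ, ℝ) f (ψ.symm y) = 0 := h _
    rw [h3] at h2
    exact hasMFDerivAt_iff_hasFDerivAt.1 h2
  have hx : ψ x ∈ ψ.target := mem_extChartAt_target x
  obtain ⟨r, hr, hb⟩ := Metric.isOpen_iff.1 ht _ hx
  have hev : ∀ᶠ y in nhds x, ψ y ∈ Metric.ball (ψ x) r ∧ y ∈ ψ.source :=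
    ((continuousAt_extChartAt x).eventually (Metric.ball_mem_nhds _ hr)).and
      (extChartAt_source_mem_nhds x)
  filter_upwards [hev] with y ⟨hy, hys⟩
  have hc := (convex_ball (ψ x) r).is_const_of_fderivWithin_eq_zero (𝕜 := ℝ) (f := f ∘ ψ.symm)
    (fun z hz => (hder z (hb hz)).differentiableAt.differentiableWithinAt)
    (fun z hz => by
      rw [fderivWithin_of_isOpen Metric.isOpen_ball hz, (hder z (hb hz)).fderiv])
    hy (Metric.mem_ball_self hr)
  simpa [ψ.left_inv hys, ψ.left_inv (mem_extChartAt_source x)] using hc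

variable [FiniteDimensional ℝ E] [RiemannianBundle (fun x : M => TangentSpace I x)]
  [IsContMDiffRiemannianBundle I ∞ E (fun x : M => TangentSpace I x)]
  {A : Π x : M, TangentSpace I x →L[ℝ] TangentSpace I x} {x : M}

/-- The trace of a smooth parallel tensor field has vanishing derivative. -/
theorem IsParallel.mvfderiv_trace (hA : IsParallel A)
    (hs : ∀ (x : M) (Y : Π x : M, TangentSpace I x), CMDiffAt ∞ (T% Y) x →
      CMDiffAt ∞ (T% (fun q => A q (Y q))) x) (x : M) :
    MDiffAt (fun q => LinearMap.trace ℝ (TangentSpace I q) (A q).toLinearMap) x ∧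
    d% (fun q => LinearMap.trace ℝ (TangentSpace I q) (A q).toLinearMap) x = 0 := by
  obtain ⟨e, he, ho⟩ := exists_orthonormal_frame I x
  have htr : (fun q => LinearMap.trace ℝ (TangentSpace I q) (A q).toLinearMap) =ᶠ[nhds x]
      fun q => ∑ i, (inner ℝ (e i q) (A q (e i q)) : ℝ) := by
    filter_upwards [ho] with q hq
    obtain ⟨b, hb⟩ := exists_orthonormalBasis hq
    rw [LinearMap.trace_eq_sum_inner _ b, hb]
    rfl
  have he' i := (he i).mdifferentiableAt (by simp)
  have hAe i := (hs x _ (he i)).mdifferentiableAt (by simp)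
  have hm i : MDiffAt (fun q => (inner ℝ (e i q) (A q (e i q)) : ℝ)) x :=
    mdifferentiableAt_inner (he' i) (hAe i)
  refine ⟨(mdifferentiableAt_sum Finset.univ hm).congr_of_eventuallyEq htr, ?_⟩
  rw [mvfderiv_congr htr]
  ext v
  set c : Fin (Module.finrank ℝ E) → Fin (Module.finrank ℝ E) → ℝ :=
    fun i j => inner ℝ (e j x) (leviCivita I M (e i) x v)
  have hc i j : c i j = -c j i := by
    have h1 : (fun q => (inner ℝ (e i q) (e j q) : ℝ)) =ᶠ[nhds x]
        fun _ => inner ℝ (e i x) (e j x) := by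
      filter_upwards [ho] with q hq
      rw [orthonormal_iff_ite.1 hq, orthonormal_iff_ite.1 ho.self_of_nhds]
    have hv : v = (extend E v : Π q : M, TangentSpace I q) x := by simp
    have h2 := mvfderiv_inner_leviCivita (mdifferentiableAt_extend I E v) (he' i) (he' j)
    rw [← hv, mvfderiv_congr h1, mvfderiv_const, zero_apply] at h2
    simp only [c]
    rw [eq_neg_iff_add_eq_zero, h2, real_inner_comm]
  have hexp i : leviCivita I M (e i) x v = ∑ j, c i j • e j x :=
    (sum_inner_smul ho.self_of_nhds _).symm
  have hd i : d% (fun q => (inner ℝ (e i q) (A q (e i q)) : ℝ)) x v =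
      ∑ j, c i j * (inner ℝ (e j x) (A x (e i x)) + inner ℝ (e i x) (A x (e j x))) := by
    have hv : v = (extend E v : Π q : M, TangentSpace I q) x := by simp
    have h2 := mvfderiv_inner_leviCivita (mdifferentiableAt_extend I E v) (he' i) (hAe i)
    rw [← hv, sub_eq_zero.1 (hA x v _ (he' i)), hexp] at h2
    rw [h2]
    simp only [sum_inner, map_sum, inner_sum, map_smul, real_inner_smul_left,
      real_inner_smul_right, mul_add, Finset.sum_add_distrib]
  rw [mvfderiv_sum _ hm, zero_apply]
  simp only [hd]
  have hS : ∀ S : ℝ, S = -S → S = 0 := fun S h => by linarith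
  refine hS _ ?_
  conv_lhs => rw [Finset.sum_comm]
  simp only [← Finset.sum_neg_distrib]
  refine Finset.sum_congr rfl fun i _ => Finset.sum_congr rfl fun j _ => ?_
  rw [hc j i]
  ring

theorem IsParallel.trace_eq [I.Boundaryless] [PreconnectedSpace M] (hA : IsParallel A)
    (hs : ∀ (x : M) (Y : Π x : M, TangentSpace I x), CMDiffAt ∞ (T% Y) x →
      CMDiffAt ∞ (T% (fun q => A q (Y q))) x) (x y : M) :
    LinearMap.trace ℝ (TangentSpace I x) (A x).toLinearMap =
      LinearMap.trace ℝ (TangentSpace I y) (A y).toLinearMap :=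
  (isLocallyConstant_of_mvfderiv_eq_zero (fun x => (hA.mvfderiv_trace hs x).1)
    (fun x => (hA.mvfderiv_trace hs x).2)).apply_eq_of_preconnectedSpace x y

theorem mdifferentiableAt_tensor_apply
    (hs : ∀ Y : Π x : M, TangentSpace I x, CMDiffAt ∞ (T% Y) x →
      CMDiffAt ∞ (T% (fun q => A q (Y q))) x) {Y : Π x : M, TangentSpace I x}
    (hY : MDiffAt (T% Y) x) : MDiffAt (T% (fun q => A q (Y q))) x := by
  obtain ⟨e, he, ho⟩ := exists_orthonormal_frame I x
  have h1 : MDiffAt (T% (fun q => ∑ i,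
      ((fun q => (inner ℝ (e i q) (Y q) : ℝ)) • fun q => A q (e i q)) q)) x :=
    MDifferentiableAt.sum_section fun i _ => MDifferentiableAt.smul_section
      (mdifferentiableAt_inner ((he i).mdifferentiableAt (by simp)) hY)
      ((hs _ (he i)).mdifferentiableAt (by simp))
  refine h1.congr_of_eventuallyEq ?_
  filter_upwards [ho] with q hq
  refine congrArg (TotalSpace.mk q) ?_
  conv_lhs => rw [← sum_inner_smul hq (Y q)]
  simp

theorem IsParallel.comp_self (hA : IsParallel A)
    (hs : ∀ (x : M) (Y : Π x : M, TangentSpace I x), CMDiffAt ∞ (T% Y) x →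
      CMDiffAt ∞ (T% (fun q => A q (Y q))) x) : IsParallel fun q => A q ∘L A q := by
  intro x v Y hY
  have h1 := hA x v Y hY
  have h2 := hA x v _ (mdifferentiableAt_tensor_apply (hs x) hY)
  simp only [ContinuousLinearMap.comp_apply]
  rw [sub_eq_zero] at *
  rw [h2, h1]

end Parallel

section LinearAlgebra

variable {F : Type*} [NormedAddCommGroup F] [InnerProductSpace ℝ F]

/-- A symmetric operator for which equality holds in `(tr T)² ≤ n tr T²` is a homothety. -/
theorem eq_smul_id_of_trace {n : ℕ} (hn : n ≠ 0) (b : OrthonormalBasis (Fin n) ℝ F)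
    {T : F →L[ℝ] F} (hT : ∀ u v, (inner ℝ (T u) v : ℝ) = inner ℝ u (T v))
    (h : n * LinearMap.trace ℝ F (T ∘L T).toLinearMap = LinearMap.trace ℝ F T.toLinearMap ^ 2) :
    T = ((n : ℝ)⁻¹ * LinearMap.trace ℝ F T.toLinearMap) • ContinuousLinearMap.id ℝ F := by
  set c := (n : ℝ)⁻¹ * LinearMap.trace ℝ F T.toLinearMap with hc
  have h1 : LinearMap.trace ℝ F T.toLinearMap = ∑ i, (inner ℝ (b i) (T (b i)) : ℝ) :=
    LinearMap.trace_eq_sum_inner _ b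
  have h2 : LinearMap.trace ℝ F (T ∘L T).toLinearMap = ∑ i, ‖T (b i)‖ ^ 2 := by
    rw [LinearMap.trace_eq_sum_inner _ b]
    refine Finset.sum_congr rfl fun i _ => ?_
    rw [← real_inner_self_eq_norm_sq, hT]
    rfl
  have h3 : ∑ i, ‖T (b i) - c • b i‖ ^ 2 = 0 := by
    have e i : ‖T (b i) - c • b i‖ ^ 2 =
        ‖T (b i)‖ ^ 2 - 2 * c * inner ℝ (b i) (T (b i)) + c ^ 2 := by
      rw [norm_sub_sq_real, real_inner_smul_right, norm_smul, b.norm_eq_one, real_inner_comm,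
        mul_one, Real.norm_eq_abs, sq_abs]
      ring
    simp only [e, Finset.sum_add_distrib, Finset.sum_sub_distrib, ← Finset.mul_sum]
    rw [← h1, ← h2, hc]
    simp only [Finset.sum_const, Finset.card_univ, Fintype.card_fin, nsmul_eq_mul]
    field_simp
    linarith
  have h4 i : T (b i) = c • b i := by
    have := (Finset.sum_eq_zero_iff_of_nonneg (fun i _ => sq_nonneg _)).1 h3 i (Finset.mem_univ i)
    exact sub_eq_zero.1 (norm_eq_zero.1 (pow_eq_zero_iff two_ne_zero |>.1 this))
  have h5 : T.toLinearMap = (c • ContinuousLinearMap.id ℝ F).toLinearMap :=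
    b.toBasis.ext fun i => by simpa using h4 i
  ext v
  exact congrArg (fun L => L v) h5

/-- On a plane, a skew operator commuting with a symmetric operator which is not a homothety
vanishes. -/
theorem eq_zero_of_skew_of_commute (b : OrthonormalBasis (Fin 2) ℝ F)
    {T : F →L[ℝ] F} (hT : ∀ u v, (inner ℝ (T u) v : ℝ) = inner ℝ u (T v))
    {R : F → F} (hR : ∀ u v, (inner ℝ (R u) v : ℝ) = -inner ℝ u (R v))
    (hTR : ∀ u, R (T u) = T (R u))
    (h : ∀ c : ℝ, T ≠ c • ContinuousLinearMap.id ℝ F) (w : F) : R w = 0 := by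
  have hb u : u = (inner ℝ (b 0) u : ℝ) • b 0 + (inner ℝ (b 1) u : ℝ) • b 1 := by
    rw [← Fin.sum_univ_two (f := fun i => (inner ℝ (b i) u : ℝ) • b i), b.sum_repr']
  have h00 : (inner ℝ (b 0) (R (b 0)) : ℝ) = 0 := by
    have := hR (b 0) (b 0); rw [real_inner_comm] at this; linarith
  have h11 : (inner ℝ (b 1) (R (b 1)) : ℝ) = 0 := by
    have := hR (b 1) (b 1); rw [real_inner_comm] at this; linarith
  have h01 : (inner ℝ (b 0) (R (b 1)) : ℝ) = -inner ℝ (b 1) (R (b 0)) := by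
    have := hR (b 0) (b 1); rw [real_inner_comm] at this; linarith
  set r : ℝ := inner ℝ (b 1) (R (b 0)) with hr
  have hR0 : R (b 0) = r • b 1 := by rw [hb (R (b 0)), h00]; simp [hr]
  have hR1 : R (b 1) = -r • b 0 := by rw [hb (R (b 1)), h11, h01]; simp
  by_cases h0 : r = 0
  · have e0 := hR w (b 0)
    have e1 := hR w (b 1)
    rw [hR0, h0, zero_smul, inner_zero_right, neg_zero, real_inner_comm] at e0
    rw [hR1, h0, neg_zero, zero_smul, inner_zero_right, neg_zero, real_inner_comm] at e1
    rw [hb (R w), e0, e1, zero_smul, zero_smul, add_zero]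
  · exfalso
    have e1 := hR (T (b 0)) (b 0)
    have e2 := hR (T (b 0)) (b 1)
    rw [hTR, hR0] at e1 e2
    rw [hR1] at e2
    simp only [map_smul, real_inner_smul_left, real_inner_smul_right] at e1 e2
    have e3 : (inner ℝ (T (b 1)) (b 0) : ℝ) = inner ℝ (T (b 0)) (b 1) := by
      rw [hT, real_inner_comm]
    have h10 : (inner ℝ (T (b 0)) (b 1) : ℝ) = 0 := by
      rw [e3] at e1
      have : r * inner ℝ (T (b 0)) (b 1) = 0 := by linarith
      exact (mul_eq_zero.1 this).resolve_left h0
    have hd : (inner ℝ (T (b 1)) (b 1) : ℝ) = inner ℝ (T (b 0)) (b 0) :=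
      mul_left_cancel₀ h0 (by linarith)
    refine h (inner ℝ (T (b 0)) (b 0)) ?_
    have h5 : T.toLinearMap =
        ((inner ℝ (T (b 0)) (b 0) : ℝ) • ContinuousLinearMap.id ℝ F).toLinearMap := by
      refine b.toBasis.ext fun i => ?_
      have e4 := hb (T (b 0))
      have e5 := hb (T (b 1))
      simp only [real_inner_comm (T (b 0)), real_inner_comm (T (b 1)), e3, h10, hd] at e4 e5
      fin_cases i
      · simpa using e4
      · simpa using e5
    ext v
    exact congrArg (fun L => L v) h5

end LinearAlgebra
end Riem

end

theorem mainTheorem12 (n : ℕ)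
    {M : Type*} [TopologicalSpace M] [ChartedSpace (EuclideanSpace ℝ (Fin 2)) M]
    [IsManifold (𝓡 2) ∞ M] [ConnectedSpace M]
    [RiemannianBundle (fun x : M => TangentSpace (𝓡 2) x)]
    [IsContMDiffRiemannianBundle (𝓡 2) ∞ (EuclideanSpace ℝ (Fin 2))
      (fun x : M => TangentSpace (𝓡 2) x)]
    {N : Type*} [TopologicalSpace N] [ChartedSpace (EuclideanSpace ℝ (Fin n)) N]
    [IsManifold (𝓡 n) ∞ N]
    [RiemannianBundle (fun y : N => TangentSpace (𝓡 n) y)]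
    [IsContMDiffRiemannianBundle (𝓡 n) ∞ (EuclideanSpace ℝ (Fin n))
      (fun y : N => TangentSpace (𝓡 n) y)]
    (φ : M → N) (hφ : Riem.IsRiemannianImmersion (𝓡 2) (𝓡 n) φ)
    (hA : Riem.IsParallel (I := 𝓡 2) (Riem.shapeOperatorH (𝓡 2) (𝓡 n) φ)) :
    Riem.IsPseudoumbilical (𝓡 2) (𝓡 n) φ ∨ Riem.IsFlat (𝓡 2) M := by
  have hsm := hφ.contMDiff
  have hE : Module.finrank ℝ (EuclideanSpace ℝ (Fin 2)) = 2 := finrank_euclideanSpace_fin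
  set A := Riem.shapeOperatorH (𝓡 2) (𝓡 n) φ
  have hs (x : M) (Y : Π x : M, TangentSpace (𝓡 2) x) 
      (hY : ContMDiffAt (𝓡 2) (𝓡 2).tangent ∞
        (fun q => (⟨q, Y q⟩ : TangentBundle (𝓡 2) M)) x) :
      ContMDiffAt (𝓡 2) (𝓡 2).tangent ∞
        (fun q => (⟨q, A q (Y q)⟩ : TangentBundle (𝓡 2) M)) x :=
    Riem.contMDiffAt_shapeOperatorH hsm hY
  have hsymm (x : M) (u v : TangentSpace (𝓡 2) x) : (inner ℝ (A x u) v : ℝ) = inner ℝ u (A x v) :=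
    Riem.inner_shapeOperatorH_comm hsm u v
  have htr (x : M) : LinearMap.trace ℝ (TangentSpace (𝓡 2) x) (A x).toLinearMap =
      2 * ‖Riem.meanCurvature (𝓡 2) (𝓡 n) φ x‖ ^ 2 := by
    have h := Riem.trace_shapeOperatorH (I := 𝓡 2) (J := 𝓡 n) (p := x) (by rw [hE]; simp) hsm
    rw [hE] at h
    exact_mod_cast h
  let b (x : M) : OrthonormalBasis (Fin 2) ℝ (TangentSpace (𝓡 2) x) :=
    (Riem.tangentBasis (𝓡 2) x).reindex (finCongr hE)
  refine or_iff_not_imp_left.2 fun hpu x u v w => ?_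
  obtain ⟨p, hp⟩ := not_forall.1 hpu
  refine Riem.eq_zero_of_skew_of_commute (b x) (hsymm x) (Riem.inner_curvature u v)
    (hA.curvature_apply (hs x) u v) (fun c hc => hp ?_) w
  have hx : 2 * LinearMap.trace ℝ (TangentSpace (𝓡 2) x) (A x ∘L A x).toLinearMap =
      LinearMap.trace ℝ (TangentSpace (𝓡 2) x) (A x).toLinearMap ^ 2 := by
    rw [LinearMap.trace_eq_sum_inner _ (b x), LinearMap.trace_eq_sum_inner _ (b x), hc]
    simp [inner_smul_right]
    ring
  have h := Riem.eq_smul_id_of_trace two_ne_zero (b p) (hsymm p) (by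
    rw [(hA.comp_self hs).trace_eq (fun x Y hY => hs x _ (hs x Y hY)) p x, hA.trace_eq hs p x]
    exact_mod_cast hx)
  refine h.trans ?_
  rw [htr]
  congr 1
  push_cast
  ring
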